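/- Let $S=\mathbb{C}[x_0,\dots,x_n]$. Let $V\subset\mathbb{P}^n_{\mathbb{C}}$ be a closed subscheme with saturated homogeneous ideal $I_V\subset S$, and let $r\ge 0$ be the dimension of $V$, so that $S/I_V$ has Krull dimension $r+1$. Assume that $V$ is generically reduced (the local ring of $V$ at the generic point of each irreducible component is reduced) and arithmetically Cohen–Macaulay ($S/I_V$ is a Cohen–Macaulay ring, i.e. its depth equals its Krull dimension). For a homogeneous ideal $I\subset S$ let $HF_{I}(k)=\dim_{\mathbb{C}}(S/I)_k$. Put $HF_V=HF_{I_V}$, and for a set $W$ of points of $\mathbb{P}^n$ put $HF_W=HF_{I_W}$, where $I_W$ is the homogeneous ideal generated by all forms that vanish on $W$. Write $\Delta HF(k)=HF(k)-HF(k-1)$, with $HF(-1)=0$. Then for a general linear space $L\subset\mathbb{P}^n$ of codimension $r$ (that is, for all $L=\{\ell_1=\dots=\ell_r=0\}$ such that the coefficients of the linear forms $\ell_1,\dots,\ell_r$ lie in a suitable nonempty Zariski open subset of $\mathbb{C}^{r(n+1)}$ which depends on $V$ and on which the forms are linearly independent), the witness point set $W=V\cap L$, regarded as a set of points, has the following property.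 Let $(h_V,h_W)$ be either the pair $(HF_V,HF_W)$ or the pair $(\Delta HF_V,\Delta HF_W)$. Then 1. for every $k\ge 0$, $$h_V(k)=\sum_{j_1=0}^{k}\sum_{j_2=0}^{j_1}\cdots\sum_{j_r=0}^{j_{r-1}}h_W(j_r)$$ (for $r=0$ this reads $h_V(k)=h_W(k)$); 2. as formal power series, $$\sum_{k\ge0}h_V(k)\,t^k=\frac{\sum_{k\ge0}h_W(k)\,t^k}{(1-t)^r}.$$ -/

import Mathlib

open MvPolynomial

noncomputable section

attribute [local instance] MvPolynomial.gradedAlgebra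

/-- The homogeneous coordinate ring `S = ℂ[x₀, …, xₙ]` of `ℙⁿ`. -/
abbrev CoordRing (n : ℕ) : Type := MvPolynomial (Fin (n + 1)) ℂ

/-- The set of closed points of `ℙⁿ` over `ℂ`. -/
abbrev ProjPoint (n : ℕ) : Type := Projectivization ℂ (Fin (n + 1) → ℂ)

/-- The irrelevant ideal `(x₀, …, xₙ)`. -/
def irrelevantIdeal (n : ℕ) : Ideal (CoordRing n) :=
  Ideal.span (Set.range (X : Fin (n + 1) → CoordRing n))

/-- A closed subscheme `V` of `ℙⁿ`, given by its saturated homogeneous ideal `I_V`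
(closed subschemes of `ℙⁿ` correspond bijectively to such ideals). -/
structure ProjSubscheme (n : ℕ) where
  /-- the ideal `I_V` -/
  ideal : Ideal (CoordRing n)
  isHomogeneous : ideal.IsHomogeneous (homogeneousSubmodule (Fin (n + 1)) ℂ)
  /-- `I_V : (x₀, …, xₙ) = I_V` -/
  saturated : ∀ f : CoordRing n, (∀ g ∈ irrelevantIdeal n, g * f ∈ ideal) → f ∈ ideal

/-- The depth (grade) of a module with respect to an ideal `J`: the supremum of the lengths of the
`M`-regular sequences of elements of `J`. -/
def moduleDepth {R : Type*} [CommRing R] (J : Ideal R) (M : Type*) [AddCommGroup M] [Module R M] :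
    ℕ∞ :=
  ⨆ (rs : List R) (_ : (∀ x ∈ rs, x ∈ J) ∧ RingTheory.Sequence.IsRegular M rs), (rs.length : ℕ∞)

namespace ProjSubscheme

variable {n : ℕ}

/-- The homogeneous coordinate ring `S / I_V`. -/
abbrev coordRing (V : ProjSubscheme n) : Type := CoordRing n ⧸ V.ideal

/-- `V` has dimension `r`: its homogeneous coordinate ring (the coordinate ring of the affine cone
over `V`) has Krull dimension `r + 1`. -/
def HasDim (V : ProjSubscheme n) (r : ℕ) : Prop :=
  ringKrullDim V.coordRing = ((r + 1 : ℕ) : WithBot ℕ∞)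

/-- `V` is generically reduced: the local ring at the generic point of every irreducible component
is reduced. -/
def IsGenericallyReduced (V : ProjSubscheme n) : Prop :=
  ∀ (p : Ideal V.coordRing) [p.IsPrime], p ∈ minimalPrimes V.coordRing →
    IsReduced (Localization.AtPrime p)

/-- `V` is arithmetically Cohen-Macaulay: the graded ring `S / I_V` is Cohen-Macaulay, i.e. its
depth (with respect to the irrelevant ideal) equals its Krull dimension. -/
def IsACM (V : ProjSubscheme n) : Prop :=
  ((moduleDepth ((irrelevantIdeal n).map (Ideal.Quotient.mk V.ideal)) V.coordRing : ℕ∞) :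
    WithBot ℕ∞) = ringKrullDim V.coordRing

/-- The set of closed points of `V`: the lines in `ℂⁿ⁺¹` on which all of `I_V` vanishes. -/
def points (V : ProjSubscheme n) : Set (ProjPoint n) :=
  {p | (p.submodule : Set (Fin (n + 1) → ℂ)) ⊆ zeroLocus ℂ V.ideal}

end ProjSubscheme

/-- The projective linear subspace of `ℙⁿ` defined by a linear subspace of `ℂⁿ⁺¹`. -/
def projLinearSpace {n : ℕ} (L : Submodule ℂ (Fin (n + 1) → ℂ)) : Set (ProjPoint n) :=
  {p | p.submodule ≤ L}

/-- The property `Q` holds for a general linear space of codimension `r` in `ℙⁿ`: there is a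
nonempty Zariski open set of `r × (n+1)` matrices of rank `r` (without loss of generality, the
nonvanishing locus of a nonzero polynomial `P` in the entries) such that `Q` holds for the linear
space cut out by the rows of any matrix in this set. -/
def ForGeneralLinearSpace (n r : ℕ) (Q : Submodule ℂ (Fin (n + 1) → ℂ) → Prop) : Prop :=
  ∃ P : MvPolynomial (Fin r × Fin (n + 1)) ℂ, P ≠ 0 ∧
    ∀ A : Matrix (Fin r) (Fin (n + 1)) ℂ, eval (fun ij => A ij.1 ij.2) P ≠ 0 →
      A.rank = r ∧ Q (LinearMap.ker A.mulVecLin)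

/-- The homogeneous ideal of a set `W` of points of `ℙⁿ` (with its reduced structure): the
polynomials vanishing on all the lines of `ℂⁿ⁺¹` that are points of `W`. -/
def pointsIdeal {n : ℕ} (W : Set (ProjPoint n)) : Ideal (CoordRing n) :=
  vanishingIdeal ℂ {v : Fin (n + 1) → ℂ | ∃ p ∈ W, v ∈ p.submodule}

/-- The Hilbert function of a homogeneous ideal `I`: the dimension of the degree `k` part
of `S / I`. -/
def hilbertFunction {n : ℕ} (I : Ideal (CoordRing n)) (k : ℕ) : ℕ :=
  Module.finrank ℂ
    ((homogeneousSubmodule (Fin (n + 1)) ℂ k).map (Ideal.Quotient.mkₐ ℂ I).toLinearMap)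

/-- The first difference `k ↦ h k - h (k - 1)` of a Hilbert function, with `h (-1) = 0`. -/
def firstDifference (h : ℕ → ℕ) : ℕ → ℤ
  | 0 => h 0
  | k + 1 => (h (k + 1) : ℤ) - h k

/-- The partial sums `k ↦ h 0 + ⋯ + h k`. -/
def partialSum {M : Type*} [AddCommMonoid M] (h : ℕ → M) (k : ℕ) : M :=
  ∑ j ∈ Finset.range (k + 1), h j

/-- The generating series `∑ h k t ^ k`. -/
def hilbertSeries (h : ℕ → ℤ) : PowerSeries ℚ :=
  PowerSeries.mk fun k => (h k : ℚ)

end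

/-! Write Σ for `partialSum`. For a homogeneous ideal I and any linear form ℓ, multiplication by ℓ
gives HF_I ≤ Σ HF_{I+(ℓ)}, with equality exactly when ℓ is regular modulo I
(`isRegularMod_iff_hilbertFunction_eq_partialSum`). It therefore suffices that, for general ℓ₁, …,
ℓᵣ, the ideal J = I_V + (ℓ₁, …, ℓᵣ) satisfies HF_V = Σʳ HF_J and is the full ideal of the points of
W. The statements on ΔHF and on power series are then formal: Δ commutes with Σ, and Σ is division
by 1 - t.

Depth r + 1 yields, by exchange and prime avoidance, one regular sequence of r + 1 linear forms
(`ProjSubscheme.IsACM.exists_isRegularSeqMod`). The first r are the rows of a matrix A₀; the last,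
y, serves as a hyperplane at infinity that misses the points. Modulo all of them the quotient
vanishes in large degrees, so semicontinuity of its Hilbert function needs only finitely many open
conditions. For general A the inequalities above are then squeezed into equalities, which gives HF_V
= Σʳ HF_J and the regularity of y modulo J (`Generically.hilbertFunction_sectionIdeal`).

It remains to see that J is radical. The ring S/I_V is finite and torsion-free over the polynomial
ring in the r + 1 forms, so generic reducedness upgrades to I_V being radical
(`isRadical_of_isRegularSeqMod`). A Bertini argument in the chart y = 1 follows
(`Generically.isRadical_sectionIdeal_sup`): the family of all sections is reduced, since its
coordinate ring embeds in a polynomial ring over that of the chart of V, and it is generically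
finite over the space of matrices. In characteristic zero its relative differentials are then
torsion, so a general fibre is unramified over ℂ, hence reduced. Regularity of y carries radicality
from the chart back to J, and the Nullstellensatz identifies J with `pointsIdeal` of W. -/

noncomputable section

attribute [local instance] MvPolynomial.gradedAlgebra

/-- `x` is a nonzerodivisor modulo the ideal `I`. -/
def IsRegularMod {R : Type*} [CommRing R] (I : Ideal R) (x : R) : Prop :=
  ∀ f, x * f ∈ I → f ∈ I

/-! ### Depth, exchange of regular elements, and regular sequences in a vector space -/

section Depth

variable {R : Type*} [CommRing R]

/-- A list of elements that is a weakly regular sequence modulo `I`. -/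
def IsRegularSeqMod : Ideal R → List R → Prop
  | _, [] => True
  | I, x :: xs => IsRegularMod I x ∧ IsRegularSeqMod (I ⊔ Ideal.span {x}) xs

/-- `J` contains a weakly regular sequence of length `s` modulo `I`. -/
def DepthGE (J : Ideal R) : ℕ → Ideal R → Prop
  | 0, _ => True
  | s + 1, I => ∃ x ∈ J, IsRegularMod I x ∧ DepthGE J s (I ⊔ Ideal.span {x})

theorem IsRegularMod.mul {I : Ideal R} {x y : R} (hx : IsRegularMod I x) (hy : IsRegularMod I y) :
    IsRegularMod I (x * y) := fun f hf => hy f (hx _ (by rwa [← mul_assoc]))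

theorem IsRegularMod.pow {I : Ideal R} {x : R} (hx : IsRegularMod I x) (n : ℕ) :
    IsRegularMod I (x ^ n) := by
  induction n with
  | zero => intro f hf; simpa using hf
  | succ n ih => rw [pow_succ]; exact ih.mul hx

theorem mem_sup_span_singleton_iff {I : Ideal R} {x f : R} :
    f ∈ I ⊔ Ideal.span {x} ↔ ∃ g, f - x * g ∈ I := by
  rw [Submodule.mem_sup]
  constructor
  · rintro ⟨i, hi, y, hy, rfl⟩
    obtain ⟨g, rfl⟩ := Ideal.mem_span_singleton'.1 hy
    exact ⟨g, by simpa [mul_comm] using hi⟩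
  · rintro ⟨g, hg⟩
    exact ⟨_, hg, x * g, Ideal.mul_mem_right _ _ (Ideal.mem_span_singleton_self x), by ring⟩

/-- If `c` is regular modulo `I` and modulo `I + (x)`, and `x` is regular modulo `I`, then `x` is
regular modulo `I + (c)`. -/
theorem IsRegularMod.swap {I : Ideal R} {x c : R} (hx : IsRegularMod I x)
    (hc' : IsRegularMod (I ⊔ Ideal.span {x}) c) : IsRegularMod (I ⊔ Ideal.span {c}) x := by
  intro f hf
  obtain ⟨g, hg⟩ := mem_sup_span_singleton_iff.1 hf
  have h1 : c * g ∈ I ⊔ Ideal.span {x} :=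
    mem_sup_span_singleton_iff.2 ⟨f, by simpa using I.neg_mem hg⟩
  obtain ⟨u, hu⟩ := mem_sup_span_singleton_iff.1 (hc' g h1)
  refine mem_sup_span_singleton_iff.2 ⟨u, hx _ ?_⟩
  have : x * (f - c * u) = (x * f - c * g) + c * (g - x * u) := by ring
  rw [this]
  exact I.add_mem hg (I.mul_mem_left _ hu)

variable {k : Type*} [Field k] [Infinite k] [Algebra k R]

/-- Prime avoidance by elements of a vector space. -/
theorem exists_mem_forall_notMem_of_not_le (E : Submodule k R) (T : Set (Ideal R)) (hT : T.Finite)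
    (h : ∀ p ∈ T, ∃ e ∈ E, e ∉ p) : ∃ e ∈ E, ∀ p ∈ T, e ∉ p := by
  classical
  have := hT.to_subtype
  by_contra! hcon
  have hcov : ⋃ p : T, (((p.1.restrictScalars k).comap E.subtype : Submodule k E) : Set E)
      = Set.univ := by
    refine Set.eq_univ_of_forall fun e => ?_
    obtain ⟨p, hp, he⟩ := hcon e.1 e.2
    exact Set.mem_iUnion.2 ⟨⟨p, hp⟩, by simpa using he⟩
  -- Over an infinite field a vector space is not a finite union of proper subspaces, so the ideals
  -- of `T` need not be prime.
  obtain ⟨p, hp⟩ := Subspace.exists_eq_top_of_iUnion_eq_univ hcov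
  obtain ⟨e, heE, hep⟩ := h p.1 p.2
  have : (⟨e, heE⟩ : E) ∈ ((p.1.restrictScalars k).comap E.subtype : Submodule k E) := by
    rw [hp]; trivial
  exact hep (by simpa using this)

/-- The hypothesis says that `E` kills no nonzero class modulo `I`, so `E` lies in no associated
prime of `R ⧸ I`. Zero divisors form the union of the finitely many associated primes, and avoidance
applies to all ideals of `T` at once. -/
theorem exists_mem_forall_isRegularMod [IsNoetherianRing R] (E : Submodule k R)
    (T : Set (Ideal R)) (hT : T.Finite)
    (h : ∀ I ∈ T, ∀ z, (∀ e ∈ E, e * z ∈ I) → z ∈ I) :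
    ∃ e ∈ E, ∀ I ∈ T, IsRegularMod I e := by
  obtain ⟨e, heE, he⟩ := exists_mem_forall_notMem_of_not_le E
    (⋃ I ∈ T, associatedPrimes R (R ⧸ I)) (hT.biUnion fun I _ => associatedPrimes.finite R (R ⧸ I))
    (by
      intro p hp
      obtain ⟨I, hI, hp⟩ := Set.mem_iUnion₂.1 hp
      have hp' := hp
      rw [AssociatedPrimes.mem_iff, isAssociatedPrime_iff] at hp
      obtain ⟨hpr, x, hx⟩ := hp
      obtain ⟨z, rfl⟩ := Ideal.Quotient.mk_surjective x
      by_contra! hcon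
      have hz : z ∈ I := by
        refine h I hI z fun e he => ?_
        have := hcon e he
        rw [hx, Submodule.mem_colon_singleton] at this
        rw [← Ideal.Quotient.eq_zero_iff_mem, map_mul]
        simpa [Algebra.smul_def] using this
      apply hpr.ne_top
      rw [hx, Ideal.Quotient.eq_zero_iff_mem.2 hz]
      ext; simp [Submodule.mem_colon_singleton])
  refine ⟨e, heE, fun I hI f hf => ?_⟩
  by_contra hfI
  have : e ∈ ⋃ p ∈ associatedPrimes R (R ⧸ I), (p : Set R) := by
    rw [biUnion_associatedPrimes_eq_zero_divisors]
    refine ⟨Ideal.Quotient.mk I f, by rwa [Ne, Ideal.Quotient.eq_zero_iff_mem], ?_⟩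
    rw [Algebra.smul_def, Ideal.Quotient.algebraMap_eq, ← map_mul, Ideal.Quotient.eq_zero_iff_mem]
    exact hf
  obtain ⟨p, hp, hep⟩ := Set.mem_iUnion₂.1 this
  exact he p (Set.mem_iUnion₂.2 ⟨I, hI, hp⟩) hep

/-- Depth at least 2 does not depend on the first element: modulo `I`, from `x z = y w` and `c z = y
u` follows `c w = x u`. Hence `w = x v` and `z = y v`. This supplies the avoidance hypothesis modulo
`I + (y)` in the exchange below. -/
theorem mem_of_forall_mul_mem_of_sup_span {J I : Ideal R} {x y c : R} (hxJ : x ∈ J)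
    (hx : IsRegularMod I x) (hy : IsRegularMod I y) (hcJ : c ∈ J)
    (hc : IsRegularMod (I ⊔ Ideal.span {x}) c) (z : R)
    (hz : ∀ j ∈ J, j * z ∈ I ⊔ Ideal.span {y}) : z ∈ I ⊔ Ideal.span {y} := by
  obtain ⟨w, hw⟩ := mem_sup_span_singleton_iff.1 (hz x hxJ)
  obtain ⟨u, hu⟩ := mem_sup_span_singleton_iff.1 (hz c hcJ)
  have h1 : c * w ∈ I ⊔ Ideal.span {x} := by
    refine mem_sup_span_singleton_iff.2 ⟨u, hy _ ?_⟩
    have : y * (c * w - x * u) = x * (c * z - y * u) - c * (x * z - y * w) := by ring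
    rw [this]
    exact I.sub_mem (I.mul_mem_left _ hu) (I.mul_mem_left _ hw)
  obtain ⟨v, hv⟩ := mem_sup_span_singleton_iff.1 (hc _ h1)
  refine mem_sup_span_singleton_iff.2 ⟨v, hx _ ?_⟩
  have : x * (z - y * v) = (x * z - y * w) + y * (w - x * v) := by ring
  rw [this]
  exact I.add_mem hw (I.mul_mem_left _ hv)

/-- Exchange of the first element of a regular sequence. -/
theorem DepthGE.exchange (k : Type*) [Field k] [Infinite k] [Algebra k R] [IsNoetherianRing R] {J : Ideal R} (s : ℕ) :
    ∀ {I : Ideal R} {x y : R}, x ∈ J → IsRegularMod I x → y ∈ J → IsRegularMod I y →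
      DepthGE J s (I ⊔ Ideal.span {x}) → DepthGE J s (I ⊔ Ideal.span {y}) := by
  induction s with
  | zero => intros; trivial
  | succ s ih =>
    intro I x y hxJ hx hyJ hy h
    obtain ⟨x₂, hx₂J, hx₂, hd⟩ := h
    obtain ⟨c, hcJ, hc⟩ := exists_mem_forall_isRegularMod (k := k) (J.restrictScalars k)
      {I, I ⊔ Ideal.span {x}, I ⊔ Ideal.span {y}} (Set.toFinite _) (by
        rintro I' (rfl | rfl | rfl) z hz
        · exact hx _ (hz x hxJ)
        · exact hx₂ _ (hz x₂ hx₂J)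
        · exact mem_of_forall_mul_mem_of_sup_span hxJ hx hy hx₂J hx₂ z hz)
    have hcI : IsRegularMod I c := hc _ (by simp)
    have hcx : IsRegularMod (I ⊔ Ideal.span {x}) c := hc _ (by simp)
    have hcy : IsRegularMod (I ⊔ Ideal.span {y}) c := hc _ (by simp)
    -- A common regular element `c` mediates: over `I + (x)` trade `x₂` for `c`, then over `I + (c)`
    -- trade `x` for `y`.
    refine ⟨c, hcJ, hcy, ?_⟩
    have h1 := ih hx₂J hx₂ hcJ hcx hd
    rw [sup_right_comm] at h1 ⊢
    exact ih hxJ (hx.swap hcx) hyJ (hy.swap hcy) h1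

theorem DepthGE.sup_span (k : Type*) [Field k] [Infinite k] [Algebra k R] [IsNoetherianRing R] {J I : Ideal R} {s : ℕ} {y : R}
    (h : DepthGE J (s + 1) I) (hyJ : y ∈ J) (hy : IsRegularMod I y) :
    DepthGE J s (I ⊔ Ideal.span {y}) := by
  obtain ⟨x, hxJ, hx, hd⟩ := h
  exact DepthGE.exchange k s hxJ hx hyJ hy hd

/-- If the depth with respect to the ideal generated by a vector space `E` is at least `s`, there
is a regular sequence of length `s` consisting of elements of `E`. -/
theorem DepthGE.exists_isRegularSeqMod [IsNoetherianRing R] (E : Submodule k R) (s : ℕ) :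
    ∀ {I : Ideal R}, DepthGE (Ideal.span (E : Set R)) s I →
      ∃ l : List R, l.length = s ∧ (∀ x ∈ l, x ∈ E) ∧ IsRegularSeqMod I l := by
  induction s with
  | zero => intro I _; exact ⟨[], rfl, by simp, trivial⟩
  | succ s ih =>
    intro I h
    have ⟨x, hxJ, hx, hd⟩ := h
    obtain ⟨e, heE, he⟩ := exists_mem_forall_isRegularMod E {I} (Set.finite_singleton I) (by
      rintro I' rfl z hz
      refine hx z ?_
      have : Ideal.span (E : Set R) ≤ I'.colon {z} := Ideal.span_le.2 fun e he => by
        simpa [Submodule.mem_colon_singleton] using hz e he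
      simpa [Submodule.mem_colon_singleton] using this hxJ)
    have heI := he I rfl
    obtain ⟨l, hl, hlE, hreg⟩ := ih (h.sup_span k (Ideal.subset_span heE) heI)
    exact ⟨e :: l, by simp [hl], by simpa using ⟨heE, hlE⟩, heI, hreg⟩

theorem depthGE_of_forall_isRegularMod {J : Ideal R} (l : List R) :
    ∀ {I : Ideal R}, (∀ x ∈ l, x ∈ J) →
      (∀ i (h : i < l.length), IsRegularMod (I ⊔ Ideal.ofList (l.take i)) l[i]) →
      ∀ s ≤ l.length, DepthGE J s I := by
  induction l with
  | nil => intro I _ _ s hs; obtain rfl : s = 0 := by simpa using hs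
           trivial
  | cons x l ih =>
    intro I hJ h s hs
    cases s with
    | zero => trivial
    | succ s =>
      have h0 : IsRegularMod (I ⊔ Ideal.ofList []) x := h 0 (by simp)
      rw [Ideal.ofList_nil, sup_bot_eq] at h0
      refine ⟨x, hJ x (by simp), h0, ih (fun y hy => hJ y (by simp [hy]))
        (fun i hi => ?_) s (by simpa using hs)⟩
      have := h (i + 1) (by simpa using hi)
      simpa [Ideal.ofList_cons, sup_assoc] using this

theorem isRegularSeqMod_append {l₁ : List R} {y : R} :
    ∀ {I : Ideal R}, IsRegularSeqMod I (l₁ ++ [y]) ↔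
      IsRegularSeqMod I l₁ ∧ IsRegularMod (I ⊔ Ideal.ofList l₁) y := by
  induction l₁ with
  | nil => simp [IsRegularSeqMod]
  | cons x l ih =>
    intro I
    simp only [List.cons_append, IsRegularSeqMod, ih, Ideal.ofList_cons, and_assoc, sup_assoc]

/-- A regular sequence in the depth computation of `R ⧸ I` lifts to `R`. -/
theorem DepthGE.of_le_moduleDepth {J I : Ideal R} {s : ℕ} (hIJ : I ≤ J)
    (h : (s : ℕ∞) ≤ moduleDepth (J.map (Ideal.Quotient.mk I)) (R ⧸ I)) : DepthGE J s I := by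
  obtain _ | s := s
  · trivial
  -- A strict inequality against the supremum produces an actual sequence of length at least `s +
  -- 1`, even for infinite depth.
  have : ((s : ℕ) : ℕ∞) < moduleDepth (J.map (Ideal.Quotient.mk I)) (R ⧸ I) :=
    lt_of_lt_of_le (by exact_mod_cast Nat.lt_succ_self s) h
  obtain ⟨rs, hrs⟩ := lt_iSup_iff.1 this
  obtain ⟨⟨hJ, hreg⟩, hlen⟩ := lt_iSup_iff.1 hrs
  have hlen : s < rs.length := by exact_mod_cast hlen
  obtain ⟨l, rfl⟩ : ∃ l : List R, l.map (Ideal.Quotient.mk I) = rs :=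
    (List.map_surjective_iff.2 Ideal.Quotient.mk_surjective) rs
  refine depthGE_of_forall_isRegularMod l (fun x hx => ?_) (fun i hi f hf => ?_) (s + 1)
    (by simpa using hlen)
  · have := hJ _ (List.mem_map_of_mem (f := Ideal.Quotient.mk I) hx)
    rw [← Ideal.mem_comap, Ideal.comap_map_of_surjective _ Ideal.Quotient.mk_surjective] at this
    simpa [← RingHom.ker_eq_comap_bot, hIJ] using this
  · have h1 := hreg.toIsWeaklyRegular.regular_mod_prev i (by simpa using hi)
    rw [isSMulRegular_quotient_iff_mem_of_smul_mem] at h1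
    have key : ∀ g : R, Ideal.Quotient.mk I g ∈
        (Ideal.ofList ((l.map (Ideal.Quotient.mk I)).take i) • ⊤ : Submodule (R ⧸ I) (R ⧸ I)) ↔
        g ∈ I ⊔ Ideal.ofList (l.take i) := by
      intro g
      rw [← List.map_take, ← Ideal.map_ofList, smul_eq_mul, Ideal.mul_top, ← Ideal.mem_comap,
        Ideal.comap_map_of_surjective _ Ideal.Quotient.mk_surjective, ← RingHom.ker_eq_comap_bot,
        Ideal.mk_ker, sup_comm]
    rw [← key]
    refine h1 _ ?_
    rw [← key] at hf
    simpa using hf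

end Depth

/-! ### Homogeneous components and homogeneous ideals -/

section Homogeneous

variable {σ k : Type*} [Field k]

theorem homogeneousComponent_add_mul {l : MvPolynomial σ k} {d : ℕ} (hl : l.IsHomogeneous d)
    (f : MvPolynomial σ k) (i : ℕ) :
    homogeneousComponent (d + i) (l * f) = l * homogeneousComponent i f := by
  conv_lhs => rw [← sum_homogeneousComponent f]
  rw [Finset.mul_sum, map_sum]
  have : ∀ j ∈ Finset.range (f.totalDegree + 1),
      homogeneousComponent (d + i) (l * homogeneousComponent j f)
        = if j = i then l * homogeneousComponent i f else 0 := by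
    intro j _
    rw [homogeneousComponent_of_mem (hl.mul (homogeneousComponent_isHomogeneous j f))]
    by_cases h : j = i
    · simp [h]
    · rw [if_neg (by omega), if_neg h]
  rw [Finset.sum_congr rfl this, Finset.sum_ite_eq']
  split_ifs with h
  · rfl
  · rw [homogeneousComponent_eq_zero _ _ (by simpa using h), mul_zero]

theorem homogeneousComponent_mul_of_lt {l : MvPolynomial σ k} {d : ℕ} (hl : l.IsHomogeneous d)
    (f : MvPolynomial σ k) {i : ℕ} (hi : i < d) : homogeneousComponent i (l * f) = 0 := by
  rw [← sum_homogeneousComponent f, Finset.mul_sum, map_sum]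
  refine Finset.sum_eq_zero fun j _ => ?_
  rw [homogeneousComponent_of_mem (hl.mul (homogeneousComponent_isHomogeneous j f)),
    if_neg (by omega)]

theorem Ideal.IsHomogeneous.sup_span {I : Ideal (MvPolynomial σ k)}
    (hI : I.IsHomogeneous (homogeneousSubmodule σ k)) {s : Set (MvPolynomial σ k)} {d : ℕ}
    (hs : ∀ x ∈ s, x.IsHomogeneous d) :
    (I ⊔ Ideal.span s).IsHomogeneous (homogeneousSubmodule σ k) :=
  hI.sup (Ideal.homogeneous_span _ _ fun x hx => ⟨d, hs x hx⟩)

/-- Over a homogeneous ideal, regularity of a homogeneous element can be tested on homogeneous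
elements. -/
theorem isRegularMod_of_forall_isHomogeneous {I : Ideal (MvPolynomial σ k)}
    (hI : I.IsHomogeneous (homogeneousSubmodule σ k)) {l : MvPolynomial σ k} {d : ℕ}
    (hl : l.IsHomogeneous d)
    (h : ∀ i, ∀ f : MvPolynomial σ k, f.IsHomogeneous i → l * f ∈ I → f ∈ I) :
    IsRegularMod I l := by
  intro f hf
  rw [mem_iff_homogeneousComponent_mem hI]
  intro i
  refine h i _ (homogeneousComponent_isHomogeneous i f) ?_
  rw [← homogeneousComponent_add_mul hl]
  exact homogeneousComponent_mem_of_mem hI hf _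

end Homogeneous

/-- Rank–nullity for `N × E → F`, whose kernel is a copy of `φ⁻¹(N)`. It is applied to
multiplication by a linear form on forms of fixed degree. -/
theorem finrank_sup_range_add_finrank_comap {k E F : Type*} [Field k] [AddCommGroup E] [Module k E]
    [AddCommGroup F] [Module k F] [Module.Finite k E] [Module.Finite k F] (φ : E →ₗ[k] F)
    (N : Submodule k F) :
    Module.finrank k (N ⊔ LinearMap.range φ : Submodule k F) + Module.finrank k (N.comap φ)
      = Module.finrank k N + Module.finrank k E := by
  have h3 := Submodule.finrank_sup_add_finrank_inf_eq N (LinearMap.range φ)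
  have h4 := LinearMap.finrank_range_add_finrank_ker φ
  have h5 := LinearMap.finrank_range_add_finrank_ker (φ.domRestrict (N.comap φ))
  rw [LinearMap.range_domRestrict, Submodule.map_comap_eq, inf_comm, LinearMap.ker_domRestrict]
    at h5
  have h6 : Module.finrank k ((LinearMap.ker φ).comap (N.comap φ).subtype)
      = Module.finrank k (LinearMap.ker φ) :=
    (Submodule.submoduleOfEquivOfLe (LinearMap.ker_le_comap _)).finrank_eq
  omega

/-! ### Hilbert functions of hyperplane sections -/

section Hilbert

variable {n : ℕ}

/-- The degree `i` part of an ideal, as a subspace of the space of forms of degree `i`. -/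
def idealPart (I : Ideal (CoordRing n)) (i : ℕ) :
    Submodule ℂ (homogeneousSubmodule (Fin (n + 1)) ℂ i) :=
  (I.restrictScalars ℂ).comap (homogeneousSubmodule (Fin (n + 1)) ℂ i).subtype

theorem mem_idealPart {I : Ideal (CoordRing n)} {i : ℕ}
    {f : homogeneousSubmodule (Fin (n + 1)) ℂ i} : f ∈ idealPart I i ↔ (f : CoordRing n) ∈ I :=
  Iff.rfl

instance finite_homogeneousSubmodule (i : ℕ) :
    Module.Finite ℂ (homogeneousSubmodule (Fin (n + 1)) ℂ i) :=
  Module.Finite.iff_fg.2 (homogeneousSubmodule_fg _ _ i)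

theorem hilbertFunction_add_finrank (I : Ideal (CoordRing n)) (i : ℕ) :
    hilbertFunction I i + Module.finrank ℂ (idealPart I i)
      = Module.finrank ℂ (homogeneousSubmodule (Fin (n + 1)) ℂ i) := by
  have h := LinearMap.finrank_range_add_finrank_ker
    ((Ideal.Quotient.mkₐ ℂ I).toLinearMap ∘ₗ (homogeneousSubmodule (Fin (n + 1)) ℂ i).subtype)
  rw [LinearMap.range_comp, Submodule.range_subtype] at h
  have hk : LinearMap.ker ((Ideal.Quotient.mkₐ ℂ I).toLinearMap ∘ₗ
      (homogeneousSubmodule (Fin (n + 1)) ℂ i).subtype) = idealPart I i := by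
    ext f
    simp [mem_idealPart, Ideal.Quotient.eq_zero_iff_mem]
  rwa [hk] at h

theorem hilbertFunction_eq_zero_iff {I : Ideal (CoordRing n)} {i : ℕ} :
    hilbertFunction I i = 0 ↔ ∀ f : CoordRing n, f.IsHomogeneous i → f ∈ I := by
  have h1 := hilbertFunction_add_finrank I i
  constructor
  · intro h f hf
    have : idealPart I i = ⊤ := Submodule.eq_top_of_finrank_eq (by omega)
    have h2 : (⟨f, hf⟩ : homogeneousSubmodule (Fin (n + 1)) ℂ i) ∈ idealPart I i := by
      rw [this]; trivial
    exact h2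
  · intro h
    have : idealPart I i = ⊤ := eq_top_iff.2 fun f _ => h f.1 f.2
    rw [this, finrank_top] at h1
    omega

/-- Multiplication by a linear form, on the space of forms of degree `i`. -/
def mulForm (l : CoordRing n) (hl : l.IsHomogeneous 1) (i : ℕ) :
    homogeneousSubmodule (Fin (n + 1)) ℂ i →ₗ[ℂ] homogeneousSubmodule (Fin (n + 1)) ℂ (1 + i) :=
  (LinearMap.mulLeft ℂ l).restrict fun _ hf => hl.mul hf

theorem idealPart_sup_span_succ {I : Ideal (CoordRing n)}
    (hI : I.IsHomogeneous (homogeneousSubmodule (Fin (n + 1)) ℂ)) {l : CoordRing n}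
    (hl : l.IsHomogeneous 1) (i : ℕ) :
    idealPart (I ⊔ Ideal.span {l}) (1 + i)
      = idealPart I (1 + i) ⊔ LinearMap.range (mulForm l hl i) := by
  ext f
  rw [mem_idealPart, mem_sup_span_singleton_iff, Submodule.mem_sup]
  constructor
  · rintro ⟨g, hg⟩
    have h := homogeneousComponent_mem_of_mem hI hg (1 + i)
    rw [map_sub, homogeneousComponent_add_mul hl, homogeneousComponent_eq_self f.2] at h
    set g' := mulForm l hl i ⟨_, homogeneousComponent_isHomogeneous i g⟩ with hg'
    exact ⟨f - g', mem_idealPart.2 h, g', LinearMap.mem_range_self _ _, sub_add_cancel f g'⟩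
  · rintro ⟨a, ha, _, ⟨g, rfl⟩, rfl⟩
    refine ⟨g, ?_⟩
    rw [mem_idealPart] at ha
    have : ((a + mulForm l hl i g : homogeneousSubmodule (Fin (n + 1)) ℂ (1 + i)) : CoordRing n)
      - l * g = a := add_sub_cancel_right (a : CoordRing n) (l * g)
    rwa [this]

theorem hilbertFunction_sup_span_zero {I : Ideal (CoordRing n)}
    (hI : I.IsHomogeneous (homogeneousSubmodule (Fin (n + 1)) ℂ)) {l : CoordRing n}
    (hl : l.IsHomogeneous 1) : hilbertFunction (I ⊔ Ideal.span {l}) 0 = hilbertFunction I 0 := by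
  have h1 := hilbertFunction_add_finrank I 0
  have h2 := hilbertFunction_add_finrank (I ⊔ Ideal.span {l}) 0
  have : idealPart (I ⊔ Ideal.span {l}) 0 = idealPart I 0 := by
    ext f
    rw [mem_idealPart, mem_idealPart, mem_sup_span_singleton_iff]
    refine ⟨fun ⟨g, hg⟩ => ?_, fun h => ⟨0, by simpa using h⟩⟩
    have h := homogeneousComponent_mem_of_mem hI hg 0
    rwa [map_sub, homogeneousComponent_mul_of_lt hl _ one_pos, sub_zero,
      homogeneousComponent_eq_self f.2] at h
  rw [this] at h2
  omega

/-- The `comap` is the degree `i` part of the colon ideal `(I : l)`; this is the dimension count for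
S/(I : l) → S/I → S/(I + (l)), the first map being multiplication by `l`. -/
theorem hilbertFunction_sup_span_succ {I : Ideal (CoordRing n)}
    (hI : I.IsHomogeneous (homogeneousSubmodule (Fin (n + 1)) ℂ)) {l : CoordRing n}
    (hl : l.IsHomogeneous 1) (i : ℕ) :
    hilbertFunction I (i + 1)
        + Module.finrank ℂ ((idealPart I (1 + i)).comap (mulForm l hl i))
      = hilbertFunction (I ⊔ Ideal.span {l}) (i + 1)
        + Module.finrank ℂ (homogeneousSubmodule (Fin (n + 1)) ℂ i) := by
  have h1 := hilbertFunction_add_finrank I (1 + i)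
  have h2 := hilbertFunction_add_finrank (I ⊔ Ideal.span {l}) (1 + i)
  rw [idealPart_sup_span_succ hI hl] at h2
  have h3 := finrank_sup_range_add_finrank_comap (mulForm l hl i) (idealPart I (1 + i))
  rw [add_comm i 1]
  omega

theorem idealPart_le_comap_mulForm (I : Ideal (CoordRing n)) {l : CoordRing n}
    (hl : l.IsHomogeneous 1) (i : ℕ) :
    idealPart I i ≤ (idealPart I (1 + i)).comap (mulForm l hl i) :=
  fun _ hf => I.mul_mem_left l hf

theorem hilbertFunction_succ_le {I : Ideal (CoordRing n)}
    (hI : I.IsHomogeneous (homogeneousSubmodule (Fin (n + 1)) ℂ)) {l : CoordRing n}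
    (hl : l.IsHomogeneous 1) (i : ℕ) :
    hilbertFunction I (i + 1) ≤ hilbertFunction I i + hilbertFunction (I ⊔ Ideal.span {l}) (i + 1) := by
  have h1 := hilbertFunction_sup_span_succ hI hl i
  have h2 := hilbertFunction_add_finrank I i
  have h3 := Submodule.finrank_mono (idealPart_le_comap_mulForm I hl i)
  omega

/-- Always `I ⊆ (I : l)`, and regularity is equality, which can be tested by dimensions degree by
degree. -/
theorem isRegularMod_iff_hilbertFunction {I : Ideal (CoordRing n)}
    (hI : I.IsHomogeneous (homogeneousSubmodule (Fin (n + 1)) ℂ)) {l : CoordRing n}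
    (hl : l.IsHomogeneous 1) :
    IsRegularMod I l ↔ ∀ i, hilbertFunction I (i + 1)
      = hilbertFunction I i + hilbertFunction (I ⊔ Ideal.span {l}) (i + 1) := by
  constructor
  · intro h i
    have h1 := hilbertFunction_sup_span_succ hI hl i
    have h2 := hilbertFunction_add_finrank I i
    have h3 : (idealPart I (1 + i)).comap (mulForm l hl i) = idealPart I i :=
      le_antisymm (fun f hf => h _ hf) (idealPart_le_comap_mulForm I hl i)
    rw [h3] at h1
    omega
  · intro h
    refine isRegularMod_of_forall_isHomogeneous hI hl fun i f hf hlf => ?_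
    have h1 := hilbertFunction_sup_span_succ hI hl i
    have h2 := hilbertFunction_add_finrank I i
    have h3 := Submodule.eq_of_le_of_finrank_eq (idealPart_le_comap_mulForm I hl i)
      (by have := h i; omega)
    have h4 : (⟨f, hf⟩ : homogeneousSubmodule (Fin (n + 1)) ℂ i)
      ∈ (idealPart I (1 + i)).comap (mulForm l hl i) := hlf
    rw [← h3] at h4
    exact h4

theorem partialSum_succ {M : Type*} [AddCommMonoid M] (h : ℕ → M) (i : ℕ) :
    partialSum h (i + 1) = partialSum h i + h (i + 1) := Finset.sum_range_succ _ _

theorem partialSum_zero {M : Type*} [AddCommMonoid M] (h : ℕ → M) : partialSum h 0 = h 0 := by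
  simp [partialSum]

theorem partialSum_mono : Monotone (partialSum : (ℕ → ℕ) → ℕ → ℕ) :=
  fun _ _ h _ => Finset.sum_le_sum fun j _ => h j

theorem partialSum_injective : Function.Injective (partialSum : (ℕ → ℕ) → ℕ → ℕ) := by
  intro f g h
  ext i
  cases i with
  | zero => simpa [partialSum_zero] using congrFun h 0
  | succ i =>
    have h1 := congrFun h (i + 1)
    rw [partialSum_succ, partialSum_succ, congrFun h i] at h1
    omega

theorem hilbertFunction_le_partialSum {I : Ideal (CoordRing n)}
    (hI : I.IsHomogeneous (homogeneousSubmodule (Fin (n + 1)) ℂ)) {l : CoordRing n}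
    (hl : l.IsHomogeneous 1) :
    hilbertFunction I ≤ partialSum (hilbertFunction (I ⊔ Ideal.span {l})) := by
  intro i
  induction i with
  | zero => rw [partialSum_zero, hilbertFunction_sup_span_zero hI hl]
  | succ i ih =>
    rw [partialSum_succ]
    exact (hilbertFunction_succ_le hI hl i).trans (by gcongr)

theorem isRegularMod_iff_hilbertFunction_eq_partialSum {I : Ideal (CoordRing n)}
    (hI : I.IsHomogeneous (homogeneousSubmodule (Fin (n + 1)) ℂ)) {l : CoordRing n}
    (hl : l.IsHomogeneous 1) :
    IsRegularMod I l ↔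
      hilbertFunction I = partialSum (hilbertFunction (I ⊔ Ideal.span {l})) := by
  rw [isRegularMod_iff_hilbertFunction hI hl]
  constructor
  · intro h
    ext i
    induction i with
    | zero => rw [partialSum_zero, hilbertFunction_sup_span_zero hI hl]
    | succ i ih => rw [partialSum_succ, h, ih]
  · intro h i
    conv_lhs => rw [h, partialSum_succ]
    rw [← h]

theorem hilbertFunction_le_partialSum_iterate (l : List (CoordRing n)) :
    ∀ {I : Ideal (CoordRing n)}, I.IsHomogeneous (homogeneousSubmodule (Fin (n + 1)) ℂ) →
      (∀ x ∈ l, x.IsHomogeneous 1) →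
      hilbertFunction I ≤ partialSum^[l.length] (hilbertFunction (I ⊔ Ideal.ofList l)) := by
  induction l with
  | nil => intro I _ _; simp
  | cons x l ih =>
    intro I hI hl
    have hx : x.IsHomogeneous 1 := hl x (by simp)
    rw [List.length_cons, Function.iterate_succ_apply', Ideal.ofList_cons, ← sup_assoc]
    refine (hilbertFunction_le_partialSum hI hx).trans (partialSum_mono (ih (hI.sup_span (d := 1) ?_) ?_))
    · rintro y rfl; exact hx
    · exact fun y hy => hl y (by simp [hy])

theorem IsRegularSeqMod.hilbertFunction_eq (l : List (CoordRing n)) :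
    ∀ {I : Ideal (CoordRing n)}, I.IsHomogeneous (homogeneousSubmodule (Fin (n + 1)) ℂ) →
      (∀ x ∈ l, x.IsHomogeneous 1) → IsRegularSeqMod I l →
      hilbertFunction I = partialSum^[l.length] (hilbertFunction (I ⊔ Ideal.ofList l)) := by
  induction l with
  | nil => intro I _ _ _; simp
  | cons x l ih =>
    intro I hI hl hreg
    have hx : x.IsHomogeneous 1 := hl x (by simp)
    rw [List.length_cons, Function.iterate_succ_apply', Ideal.ofList_cons, ← sup_assoc,
      ← ih (hI.sup_span (d := 1) ?_) ?_ hreg.2]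
    · exact (isRegularMod_iff_hilbertFunction_eq_partialSum hI hx).1 hreg.1
    · rintro y rfl; exact hx
    · exact fun y hy => hl y (by simp [hy])

/-- If a list of linear forms cuts down the Hilbert function as much as a regular sequence does,
then the last form is regular, and the others cut it down as a regular sequence does. -/
theorem hilbertFunction_eq_of_le_append {I : Ideal (CoordRing n)}
    (hI : I.IsHomogeneous (homogeneousSubmodule (Fin (n + 1)) ℂ)) {l : List (CoordRing n)}
    {y : CoordRing n} (hl : ∀ x ∈ l, x.IsHomogeneous 1) (hy : y.IsHomogeneous 1)
    (h : partialSum^[l.length + 1] (hilbertFunction (I ⊔ Ideal.ofList l ⊔ Ideal.span {y}))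
      ≤ hilbertFunction I) :
    hilbertFunction I = partialSum^[l.length] (hilbertFunction (I ⊔ Ideal.ofList l)) ∧
      IsRegularMod (I ⊔ Ideal.ofList l) y := by
  have hIl : (I ⊔ Ideal.ofList l).IsHomogeneous (homogeneousSubmodule (Fin (n + 1)) ℂ) :=
    hI.sup_span hl
  have h1 := hilbertFunction_le_partialSum_iterate l hI hl
  have h2 := partialSum_mono.iterate l.length (hilbertFunction_le_partialSum hIl hy)
  rw [← Function.iterate_succ_apply] at h2
  -- The chain HF(I) ≤ Σˢ HF(I + (l)) ≤ Σˢ⁺¹ HF(I + (l, y)) ≤ HF(I) collapses; injectivity of Σ then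
  -- strips the outer sums.
  have h3 := le_antisymm h1 (h2.trans h)
  refine ⟨h3, (isRegularMod_iff_hilbertFunction_eq_partialSum hIl hy).2
    (partialSum_injective.iterate l.length (le_antisymm
      (partialSum_mono.iterate l.length (hilbertFunction_le_partialSum hIl hy)) ?_))⟩
  rw [← Function.iterate_succ_apply, ← h3]
  exact h

end Hilbert

/-! ### Krull dimension -/

section Dimension

variable {R : Type*} [CommRing R]

theorem IsRegularMod.ringKrullDim_succ_le {I : Ideal R} {x : R} (hx : IsRegularMod I x) :
    ringKrullDim (R ⧸ I ⊔ Ideal.span {x}) + 1 ≤ ringKrullDim (R ⧸ I) := by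
  refine ringKrullDim_succ_le_of_surjective
    (Ideal.Quotient.factor (le_sup_left : I ≤ I ⊔ Ideal.span {x}))
    (Ideal.Quotient.factor_surjective _) (r := Ideal.Quotient.mk I x) ?_ ?_
  · rw [mem_nonZeroDivisors_iff_right]
    intro z hz
    obtain ⟨f, rfl⟩ := Ideal.Quotient.mk_surjective z
    rw [← map_mul, Ideal.Quotient.eq_zero_iff_mem] at hz
    exact Ideal.Quotient.eq_zero_iff_mem.2 (hx f (by rwa [mul_comm]))
  · rw [Ideal.Quotient.factor_mk, Ideal.Quotient.eq_zero_iff_mem]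
    exact Ideal.mem_sup_right (Ideal.mem_span_singleton_self x)

theorem IsRegularSeqMod.ringKrullDim_add_length_le (l : List R) :
    ∀ {I : Ideal R}, IsRegularSeqMod I l →
      ringKrullDim (R ⧸ I ⊔ Ideal.ofList l) + l.length ≤ ringKrullDim (R ⧸ I) := by
  induction l with
  | nil =>
    intro I _
    have : I ⊔ Ideal.ofList [] = I := by simp
    rw [this]
    simp
  | cons x l ih =>
    intro I h
    have h1 := ih h.2
    have h2 := h.1.ringKrullDim_succ_le
    have : I ⊔ Ideal.ofList (x :: l) = I ⊔ Ideal.span {x} ⊔ Ideal.ofList l := by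
      rw [Ideal.ofList_cons, sup_assoc]
    rw [this, List.length_cons, Nat.cast_succ, ← add_assoc]
    exact (add_le_add_left h1 1).trans h2

theorem WithBot.le_zero_of_add_natCast_le {x : WithBot ℕ∞} {m : ℕ} (h : x + m ≤ m) : x ≤ 0 := by
  induction x with
  | bot => exact bot_le
  | coe x =>
    induction x with
    | top => exact absurd h (by rw [← WithBot.coe_natCast, ← WithBot.coe_add, WithBot.coe_le_coe]; simp)
    | coe x =>
      have : x + m ≤ m := by exact_mod_cast h
      have : x = 0 := by omega
      simp [this]

/-- A graded quotient of a polynomial ring of dimension at most zero vanishes in large degrees. -/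
theorem exists_forall_isHomogeneous_mem_of_ringKrullDim_le_zero {k σ : Type*} [Field k] [Finite σ]
    {I : Ideal (MvPolynomial σ k)} (hI : I.IsHomogeneous (homogeneousSubmodule σ k))
    (h : ringKrullDim (MvPolynomial σ k ⧸ I) ≤ 0) :
    ∃ m, ∀ i, m ≤ i → ∀ f : MvPolynomial σ k, f.IsHomogeneous i → f ∈ I := by
  have h0 : Ring.KrullDimLE 0 (MvPolynomial σ k ⧸ I) := by
    rw [Ring.KrullDimLE, Order.krullDimLE_iff]
    exact h
  have hfin : Module.Finite k (MvPolynomial σ k ⧸ I) := (Module.finite_iff_krullDimLE_zero k _).2 h0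
  -- `U i` consists of the polynomials of order at least `i`. Its images in the finite-dimensional
  -- quotient decrease and stabilize, so a form of large degree `i` is congruent to a polynomial of
  -- order above `i`; comparing components of degree `i` puts it in `I`.
  let U : ℕ → Submodule k (MvPolynomial σ k) := fun i =>
    ⨅ j ∈ Finset.range i, LinearMap.ker (homogeneousComponent (R := k) (σ := σ) j)
  have hU : ∀ i f, f ∈ U i ↔ ∀ j < i, homogeneousComponent j f = 0 := by
    intro i f; simp [U]
  let V : ℕ →o (Submodule k (MvPolynomial σ k ⧸ I))ᵒᵈ :=
    ⟨fun i => OrderDual.toDual ((U i).map (Ideal.Quotient.mkₐ k I).toLinearMap), fun i j hij =>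
      Submodule.map_mono fun f hf => (hU i f).2 fun t ht => (hU j f).1 hf t (ht.trans_le hij)⟩
  obtain ⟨m, hm⟩ := IsArtinian.monotone_stabilizes V
  refine ⟨m, fun i hi f hf => ?_⟩
  have h1 : V i = V (i + 1) := (hm i hi).symm.trans (hm (i + 1) (by omega))
  have h2 : Ideal.Quotient.mkₐ k I f ∈ (U i).map (Ideal.Quotient.mkₐ k I).toLinearMap := by
    refine ⟨f, (hU i f).2 fun j hj => ?_, rfl⟩
    rw [homogeneousComponent_of_mem hf, if_neg (by omega)]
  have h3 : (U i).map (Ideal.Quotient.mkₐ k I).toLinearMap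
      = (U (i + 1)).map (Ideal.Quotient.mkₐ k I).toLinearMap := h1
  rw [h3] at h2
  obtain ⟨g, hg, hgf⟩ := h2
  have h4 : g - f ∈ I := by
    rw [← Ideal.Quotient.eq_zero_iff_mem, map_sub, sub_eq_zero]
    exact hgf
  have h5 := homogeneousComponent_mem_of_mem hI h4 i
  rw [map_sub, (hU _ g).1 hg i (by omega), homogeneousComponent_eq_self hf, zero_sub] at h5
  simpa using h5

/-- An integral extension does not lower the dimension. -/
theorem ringKrullDim_le_of_isIntegral_of_injective {A B : Type*} [CommRing A] [CommRing B]
    [Algebra A B] [Algebra.IsIntegral A B] (h : Function.Injective (algebraMap A B)) :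
    ringKrullDim A ≤ ringKrullDim B := by
  refine iSup_le fun l => ?_
  obtain ⟨P, -, hP, hPl⟩ := Ideal.exists_ideal_over_prime_of_isIntegral (S := B)
    (RelSeries.head l).asIdeal ⊥ (by
      rw [← RingHom.ker_eq_comap_bot, (RingHom.injective_iff_ker_eq_bot _).1 h]
      exact bot_le)
  have : P.LiesOver (RelSeries.head l).asIdeal := ⟨hPl.symm⟩
  obtain ⟨L, hL, -⟩ := Ideal.exists_ltSeries_of_hasGoingUp l P
  rw [← hL]
  exact le_iSup (fun l : LTSeries (PrimeSpectrum B) => (l.length : WithBot ℕ∞)) L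

end Dimension

/-! ### Torsion-freeness over the polynomial ring in a regular sequence -/

section TorsionFree

variable {σ k : Type*} [Field k]

/-- A graded Krull intersection argument: `y ^ (i + 1) * w` has no component of degree `i`, so every
component of `z` lies in `I`. -/
theorem mem_of_forall_exists_sub_pow_mul_mem {I : Ideal (MvPolynomial σ k)}
    (hI : I.IsHomogeneous (homogeneousSubmodule σ k)) {y z : MvPolynomial σ k}
    (hy : y.IsHomogeneous 1) (h : ∀ i, ∃ w, z - y ^ i * w ∈ I) : z ∈ I := by
  rw [mem_iff_homogeneousComponent_mem hI]
  intro i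
  obtain ⟨w, hw⟩ := h (i + 1)
  have h1 := homogeneousComponent_mem_of_mem hI hw i
  have h2 : (y ^ (i + 1)).IsHomogeneous (i + 1) := by simpa using hy.pow (i + 1)
  rwa [map_sub, homogeneousComponent_mul_of_lt h2 _ (by omega), sub_zero] at h1

/-- Nonzero polynomials in the elements of a regular sequence of linear forms are regular. -/
theorem IsRegularSeqMod.isRegularMod_aeval (s : ℕ) :
    ∀ {I : Ideal (MvPolynomial σ k)}, I.IsHomogeneous (homogeneousSubmodule σ k) →
      ∀ {l : Fin s → MvPolynomial σ k}, (∀ i, (l i).IsHomogeneous 1) →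
      IsRegularSeqMod I (List.ofFn l) → ∀ {p : MvPolynomial (Fin s) k}, p ≠ 0 →
      IsRegularMod I (aeval l p) := by
  induction s with
  | zero =>
    intro I _ l _ _ p hp f hf
    obtain ⟨c, rfl⟩ := C_surjective (Fin 0) p
    have hc : c ≠ 0 := by rintro rfl; simp at hp
    rw [aeval_C, ← Algebra.smul_def] at hf
    have := (I.restrictScalars k).smul_mem c⁻¹ hf
    simpa [smul_smul, hc] using this
  | succ s ih =>
    intro I hI l hl hreg p hp
    rw [List.ofFn_succ] at hreg
    have hl0 := hreg.1
    obtain ⟨φ, hφ⟩ : ∃ φ : MvPolynomial (Fin s) k →+* MvPolynomial σ k,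
        ∀ p, φ p = aeval (fun i => l i.succ) p := 
      ⟨(aeval fun i => l i.succ : MvPolynomial (Fin s) k →ₐ[k] _).toRingHom, fun _ => rfl⟩
    have key : ∀ q : Polynomial (MvPolynomial (Fin s) k),
        aeval l ((finSuccEquiv k s).symm q) =
          Polynomial.eval₂ φ (l 0) q := by
      intro q
      obtain ⟨p, rfl⟩ := (finSuccEquiv k s).surjective q
      rw [AlgEquiv.symm_apply_apply]
      induction p using MvPolynomial.induction_on with
      | C a => simp [finSuccEquiv_apply, hφ, MvPolynomial.algebraMap_eq]
      | add p q hp hq => rw [map_add, map_add, Polynomial.eval₂_add, hp, hq]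
      | mul_X p i hp =>
        rw [map_mul, map_mul, Polynomial.eval₂_mul, hp]
        congr 1
        refine Fin.cases ?_ (fun j => ?_) i
        · simp [finSuccEquiv_X_zero]
        · simp [finSuccEquiv_X_succ, hφ]
    suffices h : ∀ q : Polynomial (MvPolynomial (Fin s) k), q ≠ 0 →
        IsRegularMod I (aeval l ((finSuccEquiv k s).symm q)) by
      simpa using h (finSuccEquiv k s p) (by simpa using hp)
    intro q hq
    -- View the polynomial as one in the first variable and split off the power of that variable,
    -- which acts as a power of the regular element `l 0`. What remains has nonzero constant
    -- coefficient.
    obtain ⟨a, q', hq', rfl⟩ : ∃ (a : ℕ) (q' : Polynomial (MvPolynomial (Fin s) k)),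
        q'.coeff 0 ≠ 0 ∧ q = Polynomial.X ^ a * q' := by
      obtain ⟨q', h1, h2⟩ := Polynomial.exists_eq_pow_rootMultiplicity_mul_and_not_dvd q hq 0
      refine ⟨_, q', ?_, by simpa using h1⟩
      rwa [map_zero, sub_zero, Polynomial.X_dvd_iff] at h2
    rw [map_mul, map_mul]
    refine IsRegularMod.mul ?_ ?_
    · rw [key]
      simpa using hl0.pow a
    intro z hz
    have hI' : (I ⊔ Ideal.span {l 0}).IsHomogeneous (homogeneousSubmodule σ k) :=
      hI.sup_span (d := 1) (by rintro y rfl; exact hl 0)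
    -- Modulo `l 0` only the constant coefficient of `q'` survives, and it is regular by induction,
    -- so whatever `q'` kills is divisible by `l 0`. The quotient by `l 0` is killed as well, so
    -- this can be iterated.
    have hstep : ∀ w, aeval l ((finSuccEquiv k s).symm q') * w ∈ I →
        ∃ w', w - l 0 * w' ∈ I := by
      intro w hw
      rw [← mem_sup_span_singleton_iff]
      refine ih hI' (fun i => hl i.succ) hreg.2 hq' w ?_
      have h1 : aeval l ((finSuccEquiv k s).symm q') =
          aeval (fun i => l i.succ) (q'.coeff 0)
            + l 0 * aeval l ((finSuccEquiv k s).symm q'.divX) := by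
        rw [key, key]
        conv_lhs => rw [← Polynomial.divX_mul_X_add q']
        rw [Polynomial.eval₂_add, Polynomial.eval₂_mul, Polynomial.eval₂_X, Polynomial.eval₂_C, hφ]
        ring
      rw [h1, add_mul] at hw
      refine mem_sup_span_singleton_iff.2 ⟨-(aeval l ((finSuccEquiv k s).symm q'.divX) * w), ?_⟩
      convert hw using 1
      ring
    refine mem_of_forall_exists_sub_pow_mul_mem hI (hl 0) fun i => ?_
    suffices ∃ w, z - l 0 ^ i * w ∈ I ∧ aeval l ((finSuccEquiv k s).symm q') * w ∈ I from
      ⟨_, this.choose_spec.1⟩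
    induction i with
    | zero => exact ⟨z, by simp, hz⟩
    | succ i ihi =>
      obtain ⟨w, hw, hqw⟩ := ihi
      obtain ⟨w', hw'⟩ := hstep w hqw
      refine ⟨w', ?_, hl0 _ ?_⟩
      · have : z - l 0 ^ (i + 1) * w' = (z - l 0 ^ i * w) + l 0 ^ i * (w - l 0 * w') := by ring
        rw [this]
        exact I.add_mem hw (I.mul_mem_left _ hw')
      · set Q := aeval l ((finSuccEquiv k s).symm q')
        have : l 0 * (Q * w') = Q * w - Q * (w - l 0 * w') := by ring
        rw [this]
        exact I.sub_mem hqw (I.mul_mem_left _ hw')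

end TorsionFree

theorem mem_sup_span_range_iff {R ι : Type*} [CommRing R] [Fintype ι] {I : Ideal R} {l : ι → R}
    {f : R} : f ∈ I ⊔ Ideal.span (Set.range l) ↔ ∃ q : ι → R, f - ∑ i, l i * q i ∈ I := by
  rw [Submodule.mem_sup]
  constructor
  · rintro ⟨a, ha, y, hy, rfl⟩
    obtain ⟨c, rfl⟩ := Ideal.mem_span_range_iff_exists_fun.1 hy
    exact ⟨c, by simpa [mul_comm] using ha⟩
  · rintro ⟨q, hq⟩
    exact ⟨_, hq, _, Ideal.sum_mem _ fun i _ => Ideal.mul_mem_right _ _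
      (Ideal.subset_span ⟨i, rfl⟩), sub_add_cancel _ _⟩

/-! ### Generic reducedness -/

section GenericallyReduced

/-- In a generically reduced ring, an element outside the minimal primes kills the nilradical. -/
theorem exists_forall_isNilpotent_mul_eq_zero (k : Type*) {B : Type*} [Field k] [Infinite k]
    [CommRing B] [Algebra k B] [IsNoetherianRing B]
    (h : ∀ (p : Ideal B) [p.IsPrime], p ∈ minimalPrimes B → IsReduced (Localization.AtPrime p)) :
    ∃ s : B, (∀ p ∈ minimalPrimes B, s ∉ p) ∧ ∀ f, IsNilpotent f → s * f = 0 := by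
  obtain ⟨s, hsE, hs⟩ := exists_mem_forall_notMem_of_not_le
    ((nilradical B).annihilator.restrictScalars k) (minimalPrimes B)
    (minimalPrimes.finite_of_isNoetherianRing B) (by
      intro p hp
      have hpr : p.IsPrime := hp.1.1
      have hred := h p hp
      have hx : ∀ x ∈ nilradical B, ∃ u, u ∉ p ∧ u * x = 0 := by
        intro x hx
        have : algebraMap B (Localization.AtPrime p) x = 0 :=
          ((mem_nilradical.1 hx).map _).eq_zero
        rw [IsLocalization.map_eq_zero_iff p.primeCompl] at this
        obtain ⟨u, hu⟩ := this
        exact ⟨u.1, u.2, hu⟩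
      obtain ⟨t, ht⟩ := (isNoetherianRing_iff_ideal_fg B).1 inferInstance (nilradical B)
      choose! u hu using hx
      have htN : ∀ x ∈ t, x ∈ nilradical B := fun x hx => ht ▸ Ideal.subset_span hx
      -- Each generator of the nilradical dies in the localization at `p`, hence is killed by some
      -- `u x ∉ p`; the product kills all of them and stays outside the prime `p`.
      refine ⟨∏ x ∈ t, u x, ?_, ?_⟩
      · rw [Submodule.restrictScalars_mem, ← ht, Submodule.mem_annihilator_span]
        rintro ⟨x, hx⟩
        obtain ⟨c, hc⟩ := Finset.dvd_prod_of_mem u hx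
        rw [hc, smul_eq_mul, mul_right_comm, (hu x (htN x hx)).2, zero_mul]
      · intro hmem
        obtain ⟨x, hx, hxp⟩ := (hpr.prod_mem_iff).1 hmem
        exact (hu x (htN x hx)).1 hxp)
  exact ⟨s, hs, fun f hf => (Submodule.mem_annihilator.1 hsE) f (mem_nilradical.2 hf)⟩

/-- An element outside all minimal primes of `R ⧸ I` is a nonzerodivisor modulo the radical, which
is their intersection. -/
theorem exists_isRegularMod_radical_of_genericallyReduced (k : Type*) {R : Type*} [Field k]
    [Infinite k] [CommRing R] [Algebra k R] [IsNoetherianRing R] (I : Ideal R)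
    (h : ∀ (p : Ideal (R ⧸ I)) [p.IsPrime], p ∈ minimalPrimes (R ⧸ I) →
      IsReduced (Localization.AtPrime p)) :
    ∃ s : R, IsRegularMod I.radical s ∧ ∀ f ∈ I.radical, s * f ∈ I := by
  obtain ⟨s, hs, hs0⟩ := exists_forall_isNilpotent_mul_eq_zero k h
  obtain ⟨s, rfl⟩ := Ideal.Quotient.mk_surjective s
  have hrad : ∀ f, f ∈ I.radical ↔ IsNilpotent (Ideal.Quotient.mk I f) := fun f => by
    simp only [IsNilpotent, ← map_pow, Ideal.Quotient.eq_zero_iff_mem]; rfl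
  refine ⟨s, fun f hf => ?_, fun f hf => ?_⟩
  · rw [hrad, ← mem_nilradical, nilradical_eq_sInf, Ideal.mem_sInf]
    intro p hp
    have hp' : p.IsPrime := hp
    obtain ⟨q, hq, hqp⟩ := Ideal.exists_minimalPrimes_le (I := ⊥) (J := p) bot_le
    have hqpr : q.IsPrime := hq.1.1
    rw [hrad, ← mem_nilradical, map_mul] at hf
    exact hqp ((hqpr.mem_or_mem (nilradical_le_prime q hf)).resolve_left (hs q hq))
  · rw [← Ideal.Quotient.eq_zero_iff_mem, map_mul]
    exact hs0 _ ((hrad f).1 hf)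

end GenericallyReduced

/-! ### Graded Noether normalization and radicality -/

section Noether

variable {σ k ι : Type*} [Field k] [Finite σ] [Fintype ι]

/-- A graded quotient of a polynomial ring is finite over the subalgebra generated by linear forms
that generate an ideal containing all forms of large degree. -/
theorem finite_aeval_quotient {I : Ideal (MvPolynomial σ k)}
    (hI : I.IsHomogeneous (homogeneousSubmodule σ k)) {l : ι → MvPolynomial σ k}
    (hl : ∀ i, (l i).IsHomogeneous 1) {m : ℕ}
    (hm : ∀ i, m ≤ i → ∀ f : MvPolynomial σ k, f.IsHomogeneous i →
      f ∈ I ⊔ Ideal.span (Set.range l)) :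
    ((Ideal.Quotient.mk I).comp (aeval l : MvPolynomial ι k →ₐ[k] _).toRingHom).Finite := by
  set φ := (Ideal.Quotient.mk I).comp (aeval l : MvPolynomial ι k →ₐ[k] _).toRingHom with hφ
  let _ : Algebra (MvPolynomial ι k) (MvPolynomial σ k ⧸ I) := φ.toAlgebra
  let _ : Module (MvPolynomial ι k) (MvPolynomial σ k ⧸ I) := Algebra.toModule
  have hsmul : ∀ (p : MvPolynomial ι k) (f : MvPolynomial σ k),
      p • Ideal.Quotient.mk I f = Ideal.Quotient.mk I (aeval l p * f) := fun p f => by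
    rw [Algebra.smul_def, map_mul]; rfl
  have ht : ∀ i, ∃ t : Finset (MvPolynomial σ k), Submodule.span k (t : Set _)
      = homogeneousSubmodule σ k i := fun i => homogeneousSubmodule_fg σ k i
  choose t ht using ht
  classical
  let W : Submodule (MvPolynomial ι k) (MvPolynomial σ k ⧸ I) :=
    Submodule.span _ (((Finset.range m).biUnion t).image (Ideal.Quotient.mk I) :
      Finset (MvPolynomial σ k ⧸ I))
  have hW : ∀ i, ∀ f : MvPolynomial σ k, f.IsHomogeneous i → Ideal.Quotient.mk I f ∈ W := by
    intro i
    induction i using Nat.strong_induction_on with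
    | _ i ih =>
      intro f hf
      rcases lt_or_ge i m with hi | hi
      · have hf' : f ∈ Submodule.span k (t i : Set (MvPolynomial σ k)) := by rw [ht]; exact hf
        induction hf' using Submodule.span_induction with
        | mem x hx =>
          exact Submodule.subset_span (Finset.mem_coe.2 (Finset.mem_image_of_mem _
            (Finset.mem_biUnion.2 ⟨i, Finset.mem_range.2 hi, hx⟩)))
        | zero => simp
        | add x y hx hy hx' hy' =>
          rw [ht] at hx hy
          rw [map_add]
          exact W.add_mem (hx' hx) (hy' hy)
        | smul c x hx hx' =>
          rw [ht] at hx
          have := W.smul_mem (C c) (hx' hx)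
          rwa [hsmul, aeval_C, ← Algebra.smul_def] at this
      -- Graded Nakayama: in degree at least `m` a form is a combination of the `l x` modulo `I`,
      -- with coefficients of degree one less, to which induction applies.
      · obtain ⟨q, hq⟩ := mem_sup_span_range_iff.1 (hm i hi f hf)
        have h1 := homogeneousComponent_mem_of_mem hI hq i
        rw [map_sub, homogeneousComponent_eq_self hf, map_sum] at h1
        rw [← sub_add_cancel f (∑ x, homogeneousComponent i (l x * q x)), map_add,
          Ideal.Quotient.eq_zero_iff_mem.2 h1, zero_add, map_sum]
        refine W.sum_mem fun x _ => ?_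
        cases i with
        | zero => simp [homogeneousComponent_mul_of_lt (hl x) _ one_pos]
        | succ i =>
          rw [add_comm i 1, homogeneousComponent_add_mul (hl x)]
          have := W.smul_mem (X x) (ih i (by omega) _ (homogeneousComponent_isHomogeneous i (q x)))
          rwa [hsmul, aeval_X] at this
  suffices htop : W = ⊤ from ⟨⟨_, htop⟩⟩
  refine eq_top_iff.2 fun z _ => ?_
  obtain ⟨f, rfl⟩ := Ideal.Quotient.mk_surjective z
  rw [← sum_homogeneousComponent f, map_sum]
  exact W.sum_mem fun i _ => hW i _ (homogeneousComponent_isHomogeneous i f)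

/-- A generically reduced homogeneous ideal whose quotient is Cohen-Macaulay is radical. -/
theorem isRadical_of_isRegularSeqMod {I : Ideal (MvPolynomial σ k)}
    (hI : I.IsHomogeneous (homogeneousSubmodule σ k)) {d m : ℕ} {l : Fin d → MvPolynomial σ k}
    (hl : ∀ i, (l i).IsHomogeneous 1)
    (hm : ∀ i, m ≤ i → ∀ f : MvPolynomial σ k, f.IsHomogeneous i →
      f ∈ I ⊔ Ideal.span (Set.range l))
    (hdim : ringKrullDim (MvPolynomial σ k ⧸ I) ≤ d)
    (hreg : IsRegularSeqMod I (List.ofFn l)) {s : MvPolynomial σ k}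
    (hs : IsRegularMod I.radical s) (hs0 : ∀ f ∈ I.radical, s * f ∈ I) : I.IsRadical := by
  set I' := I.radical ⊔ Ideal.span {s} with hI'
  have hle : I ≤ I' := I.le_radical.trans le_sup_left
  have hfin := (RingHom.Finite.of_surjective (Ideal.Quotient.factor hle)
    (Ideal.Quotient.factor_surjective hle)).comp (finite_aeval_quotient hI hl hm)
  set φ := (Ideal.Quotient.factor hle).comp ((Ideal.Quotient.mk I).comp
    (aeval l : MvPolynomial (Fin d) k →ₐ[k] _).toRingHom) with hφ
  -- Since `s` is regular modulo the radical, the finite algebra S/(√I + (s)) has dimension less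
  -- than `d` and cannot contain a polynomial ring in `d` variables.
  have hninj : ¬ Function.Injective φ := by
    intro hinj
    let _ : Algebra (MvPolynomial (Fin d) k) (MvPolynomial σ k ⧸ I') := φ.toAlgebra
    have : Algebra.IsIntegral (MvPolynomial (Fin d) k) (MvPolynomial σ k ⧸ I') :=
      ⟨hfin.to_isIntegral⟩
    have h1 : ringKrullDim (MvPolynomial (Fin d) k) ≤ ringKrullDim (MvPolynomial σ k ⧸ I') :=
      ringKrullDim_le_of_isIntegral_of_injective hinj
    have h2 := hs.ringKrullDim_succ_le
    have h3 := ringKrullDim_le_of_surjective (Ideal.Quotient.factor I.le_radical)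
      (Ideal.Quotient.factor_surjective I.le_radical)
    rw [MvPolynomial.ringKrullDim_of_isNoetherianRing, ringKrullDim_eq_zero_of_field, zero_add,
      Nat.card_fin] at h1
    have h4 : ((d : ℕ) : WithBot ℕ∞) + 1 ≤ (d : ℕ) :=
      (add_le_add_left h1 1).trans (h2.trans (h3.trans hdim))
    have h5 : d + 1 ≤ d := by exact_mod_cast h4
    omega
  rw [injective_iff_map_eq_zero] at hninj
  push Not at hninj
  obtain ⟨τ, hτ, hτ0⟩ := hninj
  have hτ' : aeval l τ ∈ I' := Ideal.Quotient.eq_zero_iff_mem.1 hτ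
  obtain ⟨g, hg⟩ := mem_sup_span_singleton_iff.1 hτ'
  obtain ⟨N, hN⟩ := hg
  -- A power of τ(l) is thus a multiple of `s` modulo `I`, so it kills √I/I; being regular modulo
  -- `I`, it forces √I = I.
  obtain ⟨g', hg'⟩ : ∃ g', (aeval l τ) ^ N - s * g' ∈ I := by
    have h1 : aeval l τ - s * g ∣ (aeval l τ) ^ N - (s * g) ^ N := sub_dvd_pow_sub_pow _ _ _
    rw [← mem_sup_span_singleton_iff]
    have h2 : Ideal.Quotient.mk (I ⊔ Ideal.span {s}) (aeval l τ - s * g)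
        = Ideal.Quotient.mk (I ⊔ Ideal.span {s}) (aeval l τ) := by
      rw [Ideal.Quotient.mk_eq_mk_iff_sub_mem, sub_sub_cancel_left, neg_mem_iff]
      exact Ideal.mem_sup_right (Ideal.mul_mem_right _ _ (Ideal.mem_span_singleton_self s))
    rw [← Ideal.Quotient.eq_zero_iff_mem, map_pow, ← h2, ← map_pow, Ideal.Quotient.eq_zero_iff_mem]
    exact Ideal.mem_sup_left hN
  intro f hf
  refine (hreg.isRegularMod_aeval d hI hl (pow_ne_zero N hτ0)) f ?_
  rw [map_pow]
  have : aeval l τ ^ N * f = (aeval l τ ^ N - s * g') * f + g' * (s * f) := by ring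
  rw [this]
  exact I.add_mem (I.mul_mem_right _ hg') (I.mul_mem_left _ (hs0 f hf))

end Noether

/-! ### Properties of general matrices -/

section Generic

variable {ι κ : Type*}

/-- A property holds for the matrices in a nonempty Zariski open set. -/
def Generically (Q : Matrix ι κ ℂ → Prop) : Prop :=
  ∃ P : MvPolynomial (ι × κ) ℂ, P ≠ 0 ∧
    ∀ A : Matrix ι κ ℂ, eval (fun ij => A ij.1 ij.2) P ≠ 0 → Q A

theorem Generically.mono {Q Q' : Matrix ι κ ℂ → Prop} (h : Generically Q) (hQ : ∀ A, Q A → Q' A) :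
    Generically Q' :=
  let ⟨P, hP, h⟩ := h
  ⟨P, hP, fun A hA => hQ A (h A hA)⟩

theorem Generically.of_forall {Q : Matrix ι κ ℂ → Prop} (h : ∀ A, Q A) : Generically Q :=
  ⟨1, one_ne_zero, fun A _ => h A⟩

theorem Generically.and {Q Q' : Matrix ι κ ℂ → Prop} (h : Generically Q) (h' : Generically Q') :
    Generically fun A => Q A ∧ Q' A := by
  obtain ⟨P, hP, h⟩ := h
  obtain ⟨P', hP', h'⟩ := h'
  refine ⟨P * P', mul_ne_zero hP hP', fun A hA => ?_⟩
  rw [map_mul] at hA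
  exact ⟨h A (left_ne_zero_of_mul hA), h' A (right_ne_zero_of_mul hA)⟩

theorem Generically.forall_lt {Q : ℕ → Matrix ι κ ℂ → Prop} (h : ∀ i, Generically (Q i)) (m : ℕ) :
    Generically fun A => ∀ i < m, Q i A := by
  induction m with
  | zero => exact .of_forall fun A i hi => absurd hi (Nat.not_lt_zero i)
  | succ m ih =>
    refine (ih.and (h m)).mono fun A hA i hi => ?_
    rcases Nat.lt_succ_iff_lt_or_eq.1 hi with hi | rfl
    exacts [hA.1 i hi, hA.2]

variable [Fintype ι] [Fintype κ]

/-- Linear independence of a family of vectors that depend on a matrix in an affine way is an open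
condition. -/
theorem Generically.linearIndependent {τ F : Type*} [Finite τ] [AddCommGroup F] [Module ℂ F]
    (u : τ → Matrix ι κ ℂ → F) (a : τ → F) (b : τ → ι × κ → F)
    (hu : ∀ t A, u t A = a t + ∑ ij, A ij.1 ij.2 • b t ij) {A₀ : Matrix ι κ ℂ}
    (h₀ : LinearIndependent ℂ fun t => u t A₀) :
    Generically fun A => LinearIndependent ℂ fun t => u t A := by
  classical
  have := Fintype.ofFinite τ
  -- For a left inverse `g` at `A₀`, independence at `A` follows once the determinant of the vectors
  -- `g (u s A)` is nonzero. It is a polynomial in the entries of `A`, with value 1 at `A₀`.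
  obtain ⟨g, hg⟩ := LinearMap.exists_leftInverse_of_injective
    (Fintype.linearCombination ℂ fun t => u t A₀) (by
      rw [LinearMap.ker_eq_bot]
      exact linearIndependent_iff_injective_fintypeLinearCombination.1 h₀)
  have hg' : ∀ s, g (u s A₀) = Pi.single s 1 := fun s => by
    have := LinearMap.congr_fun hg (Pi.single s 1)
    simpa using this
  let M : Matrix τ τ (MvPolynomial (ι × κ) ℂ) := Matrix.of fun s t =>
    C (g (a s) t) + ∑ ij, X ij * C (g (b s ij) t)
  have hM : ∀ A : Matrix ι κ ℂ, eval (fun ij => A ij.1 ij.2) M.det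
      = (Matrix.of fun s => g (u s A)).det := by
    intro A
    rw [RingHom.map_det]
    congr 1
    ext s t
    simp [M, hu]
  refine ⟨M.det, fun h => ?_, fun A hA => ?_⟩
  · have h1 := hM A₀
    rw [h, map_zero] at h1
    have h2 : (Matrix.of fun s => g (u s A₀)) = (1 : Matrix τ τ ℂ) := by
      ext s t
      simp [hg', Matrix.one_apply, Pi.single_apply, eq_comm]
    rw [h2, Matrix.det_one] at h1
    exact zero_ne_one h1
  · rw [hM] at hA
    exact LinearIndependent.of_comp g (Matrix.linearIndependent_rows_of_det_ne_zero hA)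

theorem Generically.rank_eq {A₀ : Matrix ι κ ℂ} (h₀ : LinearIndependent ℂ A₀.row) :
    Generically fun A : Matrix ι κ ℂ => A.rank = Fintype.card ι := by
  classical
  refine (Generically.linearIndependent (fun i A => A i) (fun _ => 0)
    (fun i ij => if ij.1 = i then Pi.single ij.2 1 else 0) (fun i A => ?_) h₀).mono
    fun A hA => LinearIndependent.rank_matrix hA
  ext j
  simp [Fintype.sum_prod_type, Finset.sum_apply, Pi.single_apply]

end Generic

theorem exists_linearIndependent_fin_finrank {k F : Type*} [Field k] [AddCommGroup F] [Module k F]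
    {H : Submodule k F} [Module.Finite k H] (N : Submodule k H) :
    ∃ b : Fin (Module.finrank k N) → H, (∀ t, b t ∈ N) ∧
      LinearIndependent k fun t => (b t : F) :=
  ⟨fun t => Module.finBasis k N t, fun t => (Module.finBasis k N t).2,
    ((Module.finBasis k N).linearIndependent.map' N.subtype N.ker_subtype).map'
      H.subtype H.ker_subtype⟩

theorem le_finrank_of_linearIndependent {k F : Type*} [Field k] [AddCommGroup F] [Module k F]
    {H : Submodule k F} [Module.Finite k H] {N : Submodule k H} {d : ℕ} {v : Fin d → H}
    (hv : ∀ t, v t ∈ N) (h : LinearIndependent k fun t => (v t : F)) :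
    d ≤ Module.finrank k N := by
  have h1 : LinearIndependent k fun t => (⟨v t, hv t⟩ : N) :=
    LinearIndependent.of_comp (H.subtype ∘ₗ N.subtype) h
  simpa using h1.fintype_card_le_finrank

/-! ### Linear sections and semicontinuity of their Hilbert functions -/

section RowForm

variable {n r : ℕ}

/-- The linear form whose coefficients are the entries of a row of a matrix. -/
def rowForm (A : Matrix (Fin r) (Fin (n + 1)) ℂ) (i : Fin r) : CoordRing n :=
  ∑ j, C (A i j) * X j

theorem rowForm_isHomogeneous (A : Matrix (Fin r) (Fin (n + 1)) ℂ) (i : Fin r) :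
    (rowForm A i).IsHomogeneous 1 :=
  IsHomogeneous.sum _ _ _ fun _ _ => isHomogeneous_C_mul_X _ _

/-- The ideal generated by `I` and the linear forms given by the rows of `A`. -/
def sectionIdeal (I : Ideal (CoordRing n)) (A : Matrix (Fin r) (Fin (n + 1)) ℂ) :
    Ideal (CoordRing n) :=
  I ⊔ Ideal.span (Set.range (rowForm A))

theorem sectionIdeal_isHomogeneous {I : Ideal (CoordRing n)}
    (hI : I.IsHomogeneous (homogeneousSubmodule (Fin (n + 1)) ℂ))
    (A : Matrix (Fin r) (Fin (n + 1)) ℂ) :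
    (sectionIdeal I A).IsHomogeneous (homogeneousSubmodule (Fin (n + 1)) ℂ) :=
  hI.sup_span (d := 1) (by rintro _ ⟨i, rfl⟩; exact rowForm_isHomogeneous A i)

theorem exists_eq_sum_C_mul_X {f : CoordRing n} (hf : f.IsHomogeneous 1) :
    ∃ c : Fin (n + 1) → ℂ, f = ∑ j, C (c j) * X j := by
  have h : f ∈ homogeneousSubmodule (Fin (n + 1)) ℂ 1 := hf
  rw [homogeneousSubmodule_one_eq_span_X, Submodule.mem_span_range_iff_exists_fun] at h
  obtain ⟨c, rfl⟩ := h
  exact ⟨c, by simp [smul_eq_C_mul]⟩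

theorem exists_rowForm_eq {l : Fin r → CoordRing n} (hl : ∀ i, (l i).IsHomogeneous 1) :
    ∃ A : Matrix (Fin r) (Fin (n + 1)) ℂ, rowForm A = l := by
  choose c hc using fun i => exists_eq_sum_C_mul_X (hl i)
  exact ⟨Matrix.of c, funext fun i => (hc i).symm⟩

/-- A linear relation between the rows is a nonzero polynomial that vanishes at the forms; by
`IsRegularSeqMod.isRegularMod_aeval`, 0 would be regular modulo the proper ideal `I`. -/
theorem linearIndependent_row_of_isRegularSeqMod {I : Ideal (CoordRing n)}
    (hI : I.IsHomogeneous (homogeneousSubmodule (Fin (n + 1)) ℂ)) (hI1 : I ≠ ⊤)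
    {A : Matrix (Fin r) (Fin (n + 1)) ℂ} (hreg : IsRegularSeqMod I (List.ofFn (rowForm A))) :
    LinearIndependent ℂ A.row := by
  rw [Fintype.linearIndependent_iff]
  intro c hc i
  by_contra hi
  have h0 : aeval (rowForm A) (∑ i, C (c i) * X i) = 0 := by
    simp only [map_sum, map_mul, aeval_X, rowForm, Finset.mul_sum]
    rw [Finset.sum_comm]
    refine Finset.sum_eq_zero fun j _ => ?_
    have := congrFun hc j
    simp only [Finset.sum_apply, Pi.smul_apply, smul_eq_mul, Pi.zero_apply, Matrix.row] at this
    have h2 : ∑ x, C (c x) * C (A x j) = (0 : CoordRing n) := by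
      rw [← C_0, ← this, map_sum]; simp
    simp only [← mul_assoc, ← Finset.sum_mul]
    rw [show (∑ x, (aeval (rowForm A)) (C (c x)) * C (A x j)) = (0 : CoordRing n) by
      rw [← h2]; exact Finset.sum_congr rfl fun x _ => by rw [aeval_C, algebraMap_eq], zero_mul]
  have hp : (∑ i, C (c i) * X i : MvPolynomial (Fin r) ℂ) ≠ 0 := by
    intro h
    have := congrArg (coeff (Finsupp.single i 1)) h
    simp only [coeff_sum, coeff_C_mul, coeff_X, coeff_zero] at this
    simp [Finsupp.single_left_inj] at this
    exact hi this
  have := hreg.isRegularMod_aeval r hI (rowForm_isHomogeneous A) hp 1 (by rw [h0]; simp)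
  exact hI1 ((Ideal.eq_top_iff_one I).2 this)

/-- Upper semicontinuity: write a basis of the degree `k` part of the ideal at `A₀` in terms of the
generators, then keep the coefficients and vary the matrix. The resulting elements depend affinely
on `A`, so they stay independent on an open set. Taking components of degree `k` allows
inhomogeneous coefficients. -/
theorem Generically.hilbertFunction_le {I : Ideal (CoordRing n)}
    (hI : I.IsHomogeneous (homogeneousSubmodule (Fin (n + 1)) ℂ)) {y : CoordRing n}
    (hy : y.IsHomogeneous 1) (A₀ : Matrix (Fin r) (Fin (n + 1)) ℂ) (k : ℕ) :
    Generically fun A : Matrix (Fin r) (Fin (n + 1)) ℂ =>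
      hilbertFunction (sectionIdeal I A ⊔ Ideal.span {y}) k
        ≤ hilbertFunction (sectionIdeal I A₀ ⊔ Ideal.span {y}) k := by
  obtain ⟨b, hbN, hbl⟩ :=
    exists_linearIndependent_fin_finrank (idealPart (sectionIdeal I A₀ ⊔ Ideal.span {y}) k)
  have hb : ∀ t, ∃ (g : CoordRing n) (q : Fin r → CoordRing n),
      (b t : CoordRing n) - y * g - ∑ i, rowForm A₀ i * q i ∈ I := by
    intro t
    obtain ⟨g, hg⟩ := mem_sup_span_singleton_iff.1 (mem_idealPart.1 (hbN t))
    obtain ⟨q, hq⟩ := mem_sup_span_range_iff.1 hg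
    exact ⟨g, q, hq⟩
  choose g q hq using hb
  set a : _ → CoordRing n := fun t => (b t : CoordRing n) - y * g t - ∑ i, rowForm A₀ i * q t i
    with ha
  let u : _ → Matrix (Fin r) (Fin (n + 1)) ℂ → CoordRing n := fun t A =>
    homogeneousComponent k (a t + y * g t + ∑ i, rowForm A i * q t i)
  have h₀ : LinearIndependent ℂ fun t => u t A₀ := by
    have h1 : (fun t => u t A₀) = fun t => (b t : CoordRing n) := by
      funext t
      have : a t + y * g t + ∑ i, rowForm A₀ i * q t i = b t := by rw [ha]; ring
      simp only [u]
      rw [this, homogeneousComponent_eq_self (b t).2]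
    rwa [h1]
  refine (Generically.linearIndependent u (fun t => homogeneousComponent k (a t + y * g t))
    (fun t ij => homogeneousComponent k (X ij.2 * q t ij.1)) (fun t A => ?_) h₀).mono
    fun A hA => ?_
  · simp only [u, map_add]
    congr 1
    simp only [rowForm, map_sum, Finset.sum_mul, Fintype.sum_prod_type, mul_assoc,
      homogeneousComponent_C_mul, smul_eq_C_mul]
  · have hIA : (sectionIdeal I A ⊔ Ideal.span {y}).IsHomogeneous
        (homogeneousSubmodule (Fin (n + 1)) ℂ) :=
      (sectionIdeal_isHomogeneous hI A).sup_span (d := 1) (by rintro _ rfl; exact hy)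
    have hmem : ∀ t, u t A ∈ sectionIdeal I A ⊔ Ideal.span {y} := by
      intro t
      refine homogeneousComponent_mem_of_mem hIA ?_ k
      refine mem_sup_span_singleton_iff.2 ⟨g t, mem_sup_span_range_iff.2 ⟨q t, ?_⟩⟩
      convert hq t using 1
      rw [ha]
      ring
    have h1 := le_finrank_of_linearIndependent
      (H := homogeneousSubmodule (Fin (n + 1)) ℂ k)
      (N := idealPart (sectionIdeal I A ⊔ Ideal.span {y}) k)
      (v := fun t => ⟨u t A, homogeneousComponent_isHomogeneous k _⟩) hmem hA
    have h2 := hilbertFunction_add_finrank (sectionIdeal I A ⊔ Ideal.span {y}) k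
    have h3 := hilbertFunction_add_finrank (sectionIdeal I A₀ ⊔ Ideal.span {y}) k
    omega

theorem hilbertFunction_eq_zero_of_le {I : Ideal (CoordRing n)} {m k : ℕ} (hmk : m ≤ k)
    (h : hilbertFunction I m = 0) : hilbertFunction I k = 0 := by
  rw [hilbertFunction_eq_zero_iff] at h ⊢
  intro f hf
  have h1 : homogeneousSubmodule (Fin (n + 1)) ℂ k ≤ I.restrictScalars ℂ := by
    obtain ⟨j, rfl⟩ := Nat.exists_eq_add_of_le hmk
    rw [← homogeneousSubmodule_one_pow, pow_add, homogeneousSubmodule_one_pow]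
    exact Submodule.mul_le.2 fun a ha b _ => I.mul_mem_right b (h a ha)
  exact h1 hf

/-- A general linear section of a homogeneous ideal behaves like a section by a regular
sequence, if there is one section that does. -/
theorem Generically.hilbertFunction_sectionIdeal {I : Ideal (CoordRing n)}
    (hI : I.IsHomogeneous (homogeneousSubmodule (Fin (n + 1)) ℂ)) {y : CoordRing n}
    (hy : y.IsHomogeneous 1) {A₀ : Matrix (Fin r) (Fin (n + 1)) ℂ}
    (hreg : IsRegularSeqMod I (List.ofFn (rowForm A₀) ++ [y])) {m : ℕ}
    (hm : ∀ i, m ≤ i → ∀ f : CoordRing n, f.IsHomogeneous i →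
      f ∈ sectionIdeal I A₀ ⊔ Ideal.span {y}) :
    Generically fun A : Matrix (Fin r) (Fin (n + 1)) ℂ =>
      hilbertFunction I = partialSum^[r] (hilbertFunction (sectionIdeal I A)) ∧
      IsRegularMod (sectionIdeal I A) y := by
  have hlist : ∀ A : Matrix (Fin r) (Fin (n + 1)) ℂ,
      I ⊔ Ideal.ofList (List.ofFn (rowForm A)) = sectionIdeal I A := by
    intro A
    rw [sectionIdeal, Ideal.ofList]
    congr 2
    ext; simp
  have hhom : ∀ A : Matrix (Fin r) (Fin (n + 1)) ℂ,
      ∀ x ∈ List.ofFn (rowForm A), x.IsHomogeneous 1 := by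
    intro A x hx
    obtain ⟨i, rfl⟩ := List.mem_ofFn.1 hx
    exact rowForm_isHomogeneous A i
  have h0 := IsRegularSeqMod.hilbertFunction_eq _ hI (by
    intro x hx
    rcases List.mem_append.1 hx with hx | hx
    · exact hhom A₀ x hx
    · rw [List.mem_singleton.1 hx]; exact hy) hreg
  rw [Ideal.ofList_append, ← sup_assoc, hlist, Ideal.ofList_singleton, List.length_append,
    List.length_singleton, List.length_ofFn] at h0
  -- Degrees up to `m` suffice: the value at `m` is 0 for `A₀`, hence for `A`, and a Hilbert
  -- function stays 0 afterwards.
  refine (Generically.forall_lt (Generically.hilbertFunction_le hI hy A₀) (m + 1)).mono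
    fun A hA => ?_
  have hle : hilbertFunction (sectionIdeal I A ⊔ Ideal.span {y})
      ≤ hilbertFunction (sectionIdeal I A₀ ⊔ Ideal.span {y}) := by
    intro k
    rcases lt_or_ge k (m + 1) with hk | hk
    · exact hA k hk
    · have h1 := hA m (Nat.lt_succ_self m)
      rw [hilbertFunction_eq_zero_iff.2 (hm m le_rfl), Nat.le_zero] at h1
      rw [hilbertFunction_eq_zero_of_le (by omega) h1]
      exact Nat.zero_le _
  have h2 := hilbertFunction_eq_of_le_append hI (hhom A) hy (by
    rw [hlist, List.length_ofFn, h0]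
    exact partialSum_mono.iterate (r + 1) hle)
  rwa [hlist, List.length_ofFn] at h2

end RowForm

/-! ### Reducedness of general fibres via differentials -/

section GenericFibre

open nonZeroDivisors

/-- A finite reduced algebra over a field of characteristic zero is unramified. -/
theorem formallyUnramified_of_isReduced (K : Type*) {B : Type*} [Field K] [CharZero K] [CommRing B]
    [Algebra K B] [Module.Finite K B] [IsReduced B] : Algebra.FormallyUnramified K B := by
  have : IsArtinianRing B := isArtinian_of_tower K inferInstance
  let _ (m : MaximalSpectrum B) : Field (B ⧸ m.asIdeal) := Ideal.Quotient.field m.asIdeal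
  have h (m : MaximalSpectrum B) : Algebra.FormallyUnramified K (B ⧸ m.asIdeal) := by
    have : Module.Finite K (B ⧸ m.asIdeal) := inferInstance
    have : Algebra.IsSeparable K (B ⧸ m.asIdeal) := inferInstance
    exact Algebra.FormallyUnramified.of_isSeparable K _
  have : Algebra.FormallyUnramified K (Π m : MaximalSpectrum B, B ⧸ m.asIdeal) :=
    (Algebra.FormallyUnramified.pi_iff _).2 h
  exact .of_equiv ((IsArtinianRing.equivPi B).restrictScalars K).symm

/-- The differentials of a reduced algebra over a domain of characteristic zero, whose generic
fibre is finite, are torsion. -/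
theorem exists_smul_D_eq_zero {A B : Type*} [CommRing A] [IsDomain A] [CharZero A]
    [CommRing B] [Algebra A B] [IsReduced B] (t : Finset B)
    (ht : ∀ z : B, ∃ a : A, a ≠ 0 ∧ a • z ∈ Submodule.span A (t : Set B)) (z : B) :
    ∃ a : A, a ≠ 0 ∧ a • KaehlerDifferential.D A B z = 0 := by
  let K := FractionRing A
  let M := Algebra.algebraMapSubmonoid B A⁰
  let BK := Localization M
  have hBK : IsReduced BK := isReduced_localizationPreserves M _ inferInstance
  have hchar : CharZero K := charZero_of_injective_algebraMap (IsFractionRing.injective A K)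
  have hK : ∀ a : A, a ≠ 0 → IsUnit (algebraMap A K a) := fun a ha =>
    (IsUnit.mk0 _ (by simpa using ha))
  have hs : ∀ (a : A) (b : B), algebraMap B BK (a • b) = algebraMap A K a • algebraMap B BK b := by
    intro a b
    rw [Algebra.smul_def, map_mul, Algebra.smul_def, ← IsScalarTower.algebraMap_apply A B BK,
      ← IsScalarTower.algebraMap_apply A K BK]
  have hfin : Module.Finite K BK := by
    classical
    refine ⟨⟨t.image (algebraMap B BK), eq_top_iff.2 fun w _ => ?_⟩⟩
    set W := Submodule.span K ((t.image (algebraMap B BK) : Finset BK) : Set BK) with hW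
    have hspan : ∀ b ∈ Submodule.span A (t : Set B), algebraMap B BK b ∈ W := by
      intro b hb
      induction hb using Submodule.span_induction with
      | mem x hx => exact Submodule.subset_span (by simpa using ⟨x, hx, rfl⟩)
      | zero => simp
      | add x y _ _ hx hy => rw [map_add]; exact W.add_mem hx hy
      | smul c x _ hx =>
        rw [hs]
        exact W.smul_mem (algebraMap A K c) hx
    have hB : ∀ b : B, algebraMap B BK b ∈ W := by
      intro b
      obtain ⟨a, ha, hab⟩ := ht b
      have h1 := hspan _ hab
      obtain ⟨u, hu⟩ := hK a ha
      have h2 := W.smul_mem (↑u⁻¹ : K) h1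
      rw [hs, ← hu, smul_smul, Units.inv_mul, one_smul] at h2
      exact h2
    obtain ⟨b, ⟨_, a, ha, rfl⟩, rfl⟩ := IsLocalization.exists_mk'_eq M w
    obtain ⟨u, hu⟩ := hK a (nonZeroDivisors.ne_zero ha)
    have h2 := W.smul_mem (↑u⁻¹ : K) (hB b)
    convert h2 using 1
    rw [IsLocalization.mk'_eq_iff_eq_mul, Algebra.smul_def, mul_right_comm]
    have h3 : algebraMap B BK (algebraMap A B a) = algebraMap K BK (algebraMap A K a) := by
      rw [← IsScalarTower.algebraMap_apply, ← IsScalarTower.algebraMap_apply]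
    simp only
    rw [h3, ← hu, ← map_mul, Units.inv_mul, map_one, one_mul]
  have hun : Algebra.FormallyUnramified K BK := formallyUnramified_of_isReduced K
  -- The generic fibre has no differentials, and differentials commute with localization, so `D z`
  -- is killed by a nonzero element of `A`.
  have h0 : (KaehlerDifferential.map A K B BK).restrictScalars A (KaehlerDifferential.D A B z) = 0 :=
    Subsingleton.elim _ _
  rw [IsLocalizedModule.eq_zero_iff A⁰] at h0
  obtain ⟨a, ha⟩ := h0
  exact ⟨a, nonZeroDivisors.ne_zero a.2, ha⟩

/-- If an algebra over a domain of characteristic zero is reduced and its generic fibre is finite,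
then its general fibres are reduced. -/
theorem exists_ne_zero_forall_isReduced {A B ι : Type*} [CommRing A] [IsDomain A] [CharZero A]
    [CommRing B] [Algebra A B] [IsReduced B] [Finite ι] (x : ι → B) (t : Finset B)
    (ht : ∀ z : B, ∃ a : A, a ≠ 0 ∧ a • z ∈ Submodule.span A (t : Set B)) :
    ∃ h : A, h ≠ 0 ∧ ∀ (k C : Type) [Field k] [CommRing C] [Algebra k C] (ε : A →+* k)
      (π : B →+* C), (∀ a, π (algebraMap A B a) = algebraMap k C (ε a)) →
      Algebra.adjoin k (Set.range fun i => π (x i)) = ⊤ → ε h ≠ 0 → IsReduced C := by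
  have := Fintype.ofFinite ι
  choose h hh0 hh using fun i => exists_smul_D_eq_zero t ht (x i)
  refine ⟨∏ i, h i, Finset.prod_ne_zero_iff.2 fun i _ => hh0 i, ?_⟩
  intro k C _ _ _ ε π hπ hx hε
  let _ : Algebra A k := ε.toAlgebra
  let _ : Algebra B C := π.toAlgebra
  let _ : Algebra A C := ((algebraMap k C).comp ε).toAlgebra
  have : IsScalarTower A k C := IsScalarTower.of_algebraMap_eq fun _ => rfl
  have : IsScalarTower A B C := IsScalarTower.of_algebraMap_eq fun a => (hπ a).symm
  -- Push the relation `h i • D (x i) = 0` to the fibre, where `h i` becomes a nonzero scalar.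
  have hD : ∀ i, KaehlerDifferential.D k C (π (x i)) = 0 := by
    intro i
    have h1 := congrArg (KaehlerDifferential.map A k B C) (hh i)
    rw [map_zero, LinearMap.map_smul_of_tower, KaehlerDifferential.map_D] at h1
    have h2 : ε (h i) ≠ 0 := by
      rw [map_prod] at hε
      exact Finset.prod_ne_zero_iff.1 hε i (Finset.mem_univ i)
    have h3 : (ε (h i)) • KaehlerDifferential.D k C (π (x i)) = 0 := by
      rw [← h1, ← algebraMap_smul k (h i)]; rfl
    exact (smul_eq_zero_iff_right h2).1 h3
  have hD' : ∀ c : C, KaehlerDifferential.D k C c = 0 := by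
    intro c
    have h1 := Derivation.eqOn_adjoin (D1 := KaehlerDifferential.D k C)
      (D2 := (0 : Derivation k C (Ω[C⁄k]))) (s := Set.range fun i => π (x i)) (by
        rintro _ ⟨i, rfl⟩; simpa using hD i)
    rw [hx] at h1
    simpa using h1 (Algebra.mem_top (x := c))
  have hun : Algebra.FormallyUnramified k C := by
    refine ⟨?_⟩
    rw [← Submodule.subsingleton_iff C, ← subsingleton_iff_bot_eq_top,
      ← KaehlerDifferential.span_range_derivation, eq_comm, Submodule.span_eq_bot]
    rintro _ ⟨c, rfl⟩
    exact hD' c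
  have hft : Algebra.FiniteType k C := ⟨⟨(Set.finite_range fun i => π (x i)).toFinset, by simpa using hx⟩⟩
  exact Algebra.FormallyUnramified.isReduced_of_field k C

end GenericFibre

/-! ### Passing to the chart y = 1 and back -/

section Dehomogenization

variable {σ k : Type*} [Field k]

/-- Compare components in `f ≡ (y - 1) q` modulo `I`: those of `q` below degree `d` lie in `I`, and
the one of degree `d + j` is congruent to `-y ^ j * f`. Since `q` has finite degree, some `y ^ s *
f` lies in `I`. -/
theorem exists_pow_mul_mem_of_mem_sup_span_sub_one {I : Ideal (MvPolynomial σ k)}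
    (hI : I.IsHomogeneous (homogeneousSubmodule σ k)) {y f : MvPolynomial σ k}
    (hy : y.IsHomogeneous 1) {d : ℕ} (hf : f.IsHomogeneous d)
    (h : f ∈ I ⊔ Ideal.span {y - 1}) : ∃ s, y ^ s * f ∈ I := by
  obtain ⟨q, hq⟩ := mem_sup_span_singleton_iff.1 h
  have hc : ∀ i, homogeneousComponent (i + 1) f - y * homogeneousComponent i q
      + homogeneousComponent (i + 1) q ∈ I := by
    intro i
    have h1 := homogeneousComponent_mem_of_mem hI hq (i + 1)
    rw [sub_mul, one_mul, map_sub, map_sub, add_comm i 1, homogeneousComponent_add_mul hy] at h1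
    rw [add_comm i 1]
    convert h1 using 1
    ring
  have hc0 : homogeneousComponent 0 f + homogeneousComponent 0 q ∈ I := by
    have h1 := homogeneousComponent_mem_of_mem hI hq 0
    rw [sub_mul, one_mul, map_sub, map_sub, homogeneousComponent_mul_of_lt hy _ one_pos] at h1
    simpa using h1
  have hlow : ∀ i < d, homogeneousComponent i q ∈ I := by
    intro i
    induction i with
    | zero =>
      intro hi
      rwa [homogeneousComponent_of_mem hf, if_neg (by omega), zero_add] at hc0
    | succ i ih =>
      intro hi
      have h1 := hc i
      rw [homogeneousComponent_of_mem hf, if_neg (by omega)] at h1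
      have h2 := I.add_mem h1 (I.mul_mem_left y (ih (by omega)))
      convert h2 using 1
      ring
  have hd : f + homogeneousComponent d q ∈ I := by
    cases d with
    | zero => rwa [homogeneousComponent_eq_self hf] at hc0
    | succ d =>
      have h1 := I.add_mem (hc d) (I.mul_mem_left y (hlow d (Nat.lt_succ_self d)))
      rw [homogeneousComponent_eq_self hf] at h1
      convert h1 using 1
      ring
  have hhigh : ∀ j, y ^ j * f + homogeneousComponent (d + j) q ∈ I := by
    intro j
    induction j with
    | zero => simpa using hd
    | succ j ih =>
      have h1 := hc (d + j)
      rw [homogeneousComponent_of_mem hf, if_neg (by omega)] at h1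
      have h2 := I.add_mem (I.mul_mem_left y ih) h1
      rw [← add_assoc]
      convert h2 using 1
      ring
  refine ⟨q.totalDegree + 1, ?_⟩
  have h1 := hhigh (q.totalDegree + 1)
  rwa [homogeneousComponent_eq_zero _ _ (by omega), add_zero] at h1

theorem exists_isHomogeneous_sub_mem_span_sub_one {y : MvPolynomial σ k} (hy : y.IsHomogeneous 1)
    (f : MvPolynomial σ k) :
    ∃ F : MvPolynomial σ k, (∃ d, F.IsHomogeneous d) ∧ f - F ∈ Ideal.span {y - 1} := by
  refine ⟨∑ i ∈ Finset.range (f.totalDegree + 1),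
    y ^ (f.totalDegree - i) * homogeneousComponent i f, ⟨f.totalDegree, ?_⟩, ?_⟩
  · refine IsHomogeneous.sum _ _ _ fun i hi => ?_
    have h := (hy.pow (f.totalDegree - i)).mul (homogeneousComponent_isHomogeneous i f)
    rwa [one_mul, Nat.sub_add_cancel (Nat.lt_succ_iff.1 (Finset.mem_range.1 hi))] at h
  · suffices h : ∑ i ∈ Finset.range (f.totalDegree + 1), homogeneousComponent i f
        - ∑ i ∈ Finset.range (f.totalDegree + 1),
          y ^ (f.totalDegree - i) * homogeneousComponent i f ∈ Ideal.span {y - 1} by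
      rwa [sum_homogeneousComponent f] at h
    rw [← Finset.sum_sub_distrib]
    refine Ideal.sum_mem _ fun i _ => ?_
    rw [← one_sub_mul]
    refine Ideal.mul_mem_right _ _ (Ideal.mem_span_singleton.2 ?_)
    rw [← neg_sub (y ^ _) 1, dvd_neg]
    simpa using sub_dvd_pow_sub_pow y 1 (f.totalDegree - i)

/-- The dehomogenization of a radical homogeneous ideal is radical. -/
theorem isRadical_sup_span_sub_one {I : Ideal (MvPolynomial σ k)}
    (hI : I.IsHomogeneous (homogeneousSubmodule σ k)) (hrad : I.IsRadical) {y : MvPolynomial σ k}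
    (hy : y.IsHomogeneous 1) : (I ⊔ Ideal.span {y - 1}).IsRadical := by
  rintro f ⟨N, hN⟩
  obtain ⟨F, ⟨d, hF⟩, hfF⟩ := exists_isHomogeneous_sub_mem_span_sub_one hy f
  have hfF' : f - F ∈ I ⊔ Ideal.span {y - 1} := Ideal.mem_sup_right hfF
  have hFN : F ^ N ∈ I ⊔ Ideal.span {y - 1} := by
    have h1 := Ideal.mem_of_dvd _ (sub_dvd_pow_sub_pow f F N) hfF'
    simpa using Ideal.sub_mem _ hN h1
  obtain ⟨s, hs⟩ := exists_pow_mul_mem_of_mem_sup_span_sub_one hI hy (hF.pow N) hFN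
  -- The factor `y` absorbs the power `y ^ s`, and is harmless because `y` is 1 in the chart.
  have hyF : y * F ∈ I := by
    refine hrad ⟨s + N, ?_⟩
    have : (y * F) ^ (s + N) = y ^ N * F ^ s * (y ^ s * F ^ N) := by ring
    rw [this]
    exact I.mul_mem_left _ hs
  have : f = (f - F) - (y - 1) * F + y * F := by ring
  rw [this]
  refine Ideal.add_mem _ (Ideal.sub_mem _ hfF' ?_) (Ideal.mem_sup_left hyF)
  exact Ideal.mem_sup_right (Ideal.mul_mem_right _ _ (Ideal.mem_span_singleton_self _))

/-- A homogeneous ideal is radical if a dehomogenization with respect to a regular linear form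
is radical. -/
theorem isRadical_of_isRadical_sup_span_sub_one {I : Ideal (MvPolynomial σ k)}
    (hI : I.IsHomogeneous (homogeneousSubmodule σ k)) {y : MvPolynomial σ k}
    (hy : y.IsHomogeneous 1) (hreg : IsRegularMod I y)
    (h : (I ⊔ Ideal.span {y - 1}).IsRadical) : I.IsRadical := by
  intro f hf
  rw [mem_iff_homogeneousComponent_mem hI]
  intro i
  obtain ⟨N, hN⟩ := homogeneousComponent_mem_of_mem hI.radical hf i
  obtain ⟨s, hs⟩ := exists_pow_mul_mem_of_mem_sup_span_sub_one hI hy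
    (homogeneousComponent_isHomogeneous i f) (h ⟨N, Ideal.mem_sup_left hN⟩)
  exact hreg.pow s _ hs

end Dehomogenization

/-- The adjugate trick: multiply the vector of relations by the adjugate of `M`. -/
theorem det_smul_mem {A V ι : Type*} [CommRing A] [AddCommGroup V] [Module A V] [Fintype ι]
    [DecidableEq ι] (M : Matrix ι ι A) (v : ι → V) (W : Submodule A V)
    (h : ∀ i, ∑ j, M i j • v j ∈ W) (i : ι) : M.det • v i ∈ W := by
  have h1 : ∑ a, M.adjugate i a • ∑ j, M a j • v j = M.det • v i := by
    simp only [Finset.smul_sum, smul_smul]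
    rw [Finset.sum_comm]
    simp only [← Finset.sum_smul, ← Matrix.mul_apply, Matrix.adjugate_mul, Matrix.smul_apply,
      Matrix.one_apply, smul_eq_mul, mul_ite, mul_one, mul_zero, ite_smul, zero_smul,
      Finset.sum_ite_eq, Finset.mem_univ, if_true]
  rw [← h1]
  exact W.sum_mem fun a _ => W.smul_mem _ (h a)

theorem sum_sub_mul_mul_eq_zero {P ι : Type*} [CommRing P] [Fintype ι] (a d e : ι → P)
    (h : ∑ j, d j * e j = 1) : ∑ j, (a j - d j * ∑ i, a i * e i) * e j = 0 := by
  have : ∀ j, (a j - d j * ∑ i, a i * e i) * e j = a j * e j - (∑ i, a i * e i) * (d j * e j) :=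
    fun j => by ring
  simp only [this, Finset.sum_sub_distrib, ← Finset.mul_sum, h, mul_one, sub_self]

/-! ### The universal family of sections in the chart, and its reducedness -/

section Universal

/-- The ring of polynomials in the entries of an `r × (n + 1)` matrix. -/
abbrev ParamRing (n r : ℕ) : Type := MvPolynomial (Fin r × Fin (n + 1)) ℂ

variable {n : ℕ}

/-- The linear forms given by the rows of the generic matrix. -/
def univForm {r : ℕ} (i : Fin r) : MvPolynomial (Fin (n + 1)) (ParamRing n r) :=
  ∑ j, C (X (i, j)) * X j

/-- The ideal of the universal family of dehomogenized linear sections. -/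
def univIdeal (r : ℕ) (I : Ideal (CoordRing n)) (y : CoordRing n) :
    Ideal (MvPolynomial (Fin (n + 1)) (ParamRing n r)) :=
  I.map (MvPolynomial.map C) ⊔ Ideal.span (Set.range univForm) ⊔
    Ideal.span {MvPolynomial.map C y - 1}

variable {r : ℕ} {I : Ideal (CoordRing n)} {y : CoordRing n}

theorem forall_mem_univIdeal_iff {B : Type*} [CommRing B]
    {φ : MvPolynomial (Fin (n + 1)) (ParamRing n r) →+* B} :
    (∀ z ∈ univIdeal r I y, φ z = 0) ↔ (∀ f ∈ I, φ (MvPolynomial.map C f) = 0) ∧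
      (∀ i, φ (univForm i) = 0) ∧ φ (MvPolynomial.map C y) = 1 := by
  change univIdeal r I y ≤ RingHom.ker φ ↔ _
  rw [univIdeal, sup_le_iff, sup_le_iff, Ideal.map_le_iff_le_comap, Ideal.span_le, Ideal.span_le,
    Set.range_subset_iff, Set.singleton_subset_iff, and_assoc]
  simp only [SetLike.mem_coe, RingHom.mem_ker, map_sub, map_one, sub_eq_zero]
  rfl

section Trivialization

variable {Q : Type*} [CommRing Q] [Algebra ℂ Q]

/-- The substitution that trivializes the universal family over the dehomogenization. -/
def univTrivialization (r : ℕ) (q : CoordRing n →ₐ[ℂ] Q) (c : Fin (n + 1) → ℂ) :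
    MvPolynomial (Fin (n + 1)) (ParamRing n r) →+* MvPolynomial (Fin r × Fin (n + 1)) Q :=
  -- Each generic row `a` is replaced by `a - (a · x) c`. When `c · x = y = 1`, this projects it
  -- onto the rows whose linear form vanishes at `x`.
  eval₂Hom
    (eval₂Hom (C.comp (algebraMap ℂ Q)) fun ij => X ij - C (algebraMap ℂ Q (c ij.2)) *
      ∑ j, X (ij.1, j) * C (q (X j)))
    fun j => C (q (X j))

theorem univTrivialization_X (q : CoordRing n →ₐ[ℂ] Q) (c : Fin (n + 1) → ℂ) (j : Fin (n + 1)) :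
    univTrivialization r q c (X j) = C (q (X j)) := by
  rw [univTrivialization, coe_eval₂Hom, eval₂_X]

theorem univTrivialization_C_X (q : CoordRing n →ₐ[ℂ] Q) (c : Fin (n + 1) → ℂ)
    (ij : Fin r × Fin (n + 1)) :
    univTrivialization r q c (C (X ij)) = X ij - C (algebraMap ℂ Q (c ij.2)) *
      ∑ j, X (ij.1, j) * C (q (X j)) := by
  rw [univTrivialization, coe_eval₂Hom, eval₂_C, coe_eval₂Hom, eval₂_X]

theorem univTrivialization_map (q : CoordRing n →ₐ[ℂ] Q) (c : Fin (n + 1) → ℂ) (f : CoordRing n) :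
    univTrivialization r q c (MvPolynomial.map C f) = C (q f) := by
  have : (univTrivialization r q c).comp (MvPolynomial.map C)
      = C.comp (q : CoordRing n →+* Q) := by
    refine MvPolynomial.ringHom_ext (fun a => ?_) fun j => ?_
    · simp [univTrivialization, ← MvPolynomial.algebraMap_eq]
    · simp [univTrivialization]
  exact RingHom.congr_fun this f

theorem univTrivialization_eq_zero {q : CoordRing n →ₐ[ℂ] Q} {c : Fin (n + 1) → ℂ}
    (hc : y = ∑ j, C (c j) * X j) (hqI : ∀ f ∈ I, q f = 0) (hqy : q y = 1) :
    ∀ z ∈ univIdeal r I y, univTrivialization r q c z = 0 := by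
  rw [forall_mem_univIdeal_iff]
  refine ⟨fun f hf => ?_, fun i => ?_, ?_⟩
  · rw [univTrivialization_map, hqI f hf, C_0]
  · have h2 : ∑ j, algebraMap ℂ Q (c j) * q (X j) = 1 := by
      rw [← hqy, hc, map_sum]
      exact Finset.sum_congr rfl fun j _ => by
        rw [map_mul, ← MvPolynomial.algebraMap_eq, AlgHom.commutes]
    have h1 : ∑ j, C (algebraMap ℂ Q (c j)) * C (q (X j))
        = (1 : MvPolynomial (Fin r × Fin (n + 1)) Q) := by
      rw [← C_1, ← h2, map_sum]
      exact Finset.sum_congr rfl fun j _ => by rw [map_mul]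
    rw [univForm, map_sum, ← sum_sub_mul_mul_eq_zero (fun j => X (i, j)) _ _ h1]
    exact Finset.sum_congr rfl fun j _ => by
      rw [map_mul, univTrivialization_C_X, univTrivialization_X]
  · rw [univTrivialization_map, hqy, C_1]

/-- A ring homomorphism out of the universal family factors through the trivialization. -/
theorem exists_comp_univTrivialization {B : Type*} [CommRing B]
    {φ : MvPolynomial (Fin (n + 1)) (ParamRing n r) →+* B}
    (hφ : ∀ z ∈ univIdeal r I y, φ z = 0) {q : CoordRing n →ₐ[ℂ] Q}
    (hq : Function.Surjective q) (hqker : ∀ f, q f = 0 → f ∈ I ⊔ Ideal.span {y - 1})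
    (c : Fin (n + 1) → ℂ) :
    ∃ Φ : MvPolynomial (Fin r × Fin (n + 1)) Q →+* B,
      ∀ z, Φ (univTrivialization r q c z) = φ z := by
  have hmk := forall_mem_univIdeal_iff.1 hφ
  let ρ : CoordRing n →+* B := φ.comp (MvPolynomial.map C)
  have hρ : I ⊔ Ideal.span {y - 1} ≤ RingHom.ker ρ := by
    rw [sup_le_iff, Ideal.span_singleton_le_iff_mem]
    refine ⟨fun f hf => hmk.1 f hf, ?_⟩
    rw [RingHom.mem_ker, map_sub, map_one, sub_eq_zero]
    exact hmk.2.2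
  obtain ⟨ψ, hψ⟩ : ∃ ψ : Q →+* B, ∀ f, ψ (q f) = ρ f := by
    refine ⟨(q : CoordRing n →+* Q).liftOfSurjective hq ⟨ρ, fun f hf => hρ (hqker f hf)⟩,
      fun f => ?_⟩
    exact RingHom.liftOfRightInverse_comp_apply _ _ _ _ f
  obtain ⟨Φ, hΦC, hΦX⟩ : ∃ Φ : MvPolynomial (Fin r × Fin (n + 1)) Q →+* B,
      (∀ f, Φ (C (q f)) = φ (MvPolynomial.map C f)) ∧ ∀ ij, Φ (X ij) = φ (C (X ij)) := by
    refine ⟨eval₂Hom ψ fun ij => φ (C (X ij)), fun f => ?_, fun ij => ?_⟩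
    · rw [coe_eval₂Hom, eval₂_C, hψ]; rfl
    · rw [coe_eval₂Hom, eval₂_X]
  refine ⟨Φ, fun z => RingHom.congr_fun (f := Φ.comp (univTrivialization r q c)) (g := φ) ?_ z⟩
  refine MvPolynomial.ringHom_ext (fun a => ?_) fun j => ?_
  · refine RingHom.congr_fun (f := (Φ.comp (univTrivialization r q c)).comp C) (g := φ.comp C) ?_ a
    refine MvPolynomial.ringHom_ext (fun b => ?_) fun ij => ?_
    · have h1 : univTrivialization r q c (C (C b)) = C (q (C b)) := by
        rw [← univTrivialization_map (r := r) q c, map_C]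
      rw [RingHom.comp_apply, RingHom.comp_apply, h1, hΦC, map_C]
      rfl
    · have h1 : ∑ j, φ (C (X (ij.1, j))) * φ (X j) = 0 := by
        rw [← hmk.2.1 ij.1, univForm, map_sum]
        exact Finset.sum_congr rfl fun j _ => by rw [map_mul]
      have h2 : Φ (∑ j, X (ij.1, j) * C (q (X j))) = 0 := by
        rw [← h1, map_sum]
        exact Finset.sum_congr rfl fun j _ => by rw [map_mul, hΦX, hΦC, map_X]
      rw [RingHom.comp_apply, RingHom.comp_apply, univTrivialization_C_X, map_sub, map_mul, h2,
        mul_zero, sub_zero, hΦX]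
      rfl
  · rw [RingHom.comp_apply, univTrivialization_X, hΦC, map_X]

end Trivialization

/-- The universal family of dehomogenized linear sections of a reduced scheme is reduced. -/
theorem isReduced_quotient_univIdeal (hrad : (I ⊔ Ideal.span {y - 1}).IsRadical)
    {c : Fin (n + 1) → ℂ} (hc : y = ∑ j, C (c j) * X j) :
    IsReduced (MvPolynomial (Fin (n + 1)) (ParamRing n r) ⧸ univIdeal r I y) := by
  have hred : IsReduced (CoordRing n ⧸ I ⊔ Ideal.span {y - 1}) :=
    (Ideal.isRadical_iff_quotient_reduced _).1 hrad
  set q := Ideal.Quotient.mkₐ ℂ (I ⊔ Ideal.span {y - 1}) with hq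
  have hq0 : ∀ f, q f = 0 ↔ f ∈ I ⊔ Ideal.span {y - 1} := fun f => Ideal.Quotient.eq_zero_iff_mem
  have hqy : q y = 1 := by
    rw [← sub_eq_zero, ← map_one q, ← map_sub, hq0]
    exact Ideal.mem_sup_right (Ideal.mem_span_singleton_self _)
  obtain ⟨Φ, hΦ⟩ := exists_comp_univTrivialization (r := r) (I := I) (y := y)
    (B := MvPolynomial (Fin (n + 1)) (ParamRing n r) ⧸ univIdeal r I y)
    (φ := Ideal.Quotient.mk (univIdeal r I y)) (fun z hz => Ideal.Quotient.eq_zero_iff_mem.2 hz)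
    (Ideal.Quotient.mkₐ_surjective ℂ _) (fun f hf => (hq0 f).1 hf) c
  have h0 := univTrivialization_eq_zero (r := r) hc
    (fun f hf => (hq0 f).2 (Ideal.mem_sup_left hf)) hqy
  rw [← Ideal.isRadical_iff_quotient_reduced]
  rintro f ⟨N, hN⟩
  have h1 := h0 _ hN
  rw [map_pow] at h1
  -- `Φ` inverts the trivialization on the left, so the family embeds in a polynomial ring over the
  -- reduced chart.
  rw [← Ideal.Quotient.eq_zero_iff_mem, ← hΦ, eq_zero_of_pow_eq_zero h1, map_zero]

end Universal

/-! ### Generic finiteness of the universal family -/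

section UniversalFinite

variable {n r : ℕ} {I : Ideal (CoordRing n)} {y : CoordRing n}

theorem exists_isHomogeneous_of_mem_sectionIdeal_sup
    (hI : I.IsHomogeneous (homogeneousSubmodule (Fin (n + 1)) ℂ)) (hy : y.IsHomogeneous 1)
    {A : Matrix (Fin r) (Fin (n + 1)) ℂ} {μ : ℕ} {f : CoordRing n} (hf : f.IsHomogeneous (1 + μ))
    (h : f ∈ sectionIdeal I A ⊔ Ideal.span {y}) :
    ∃ (p : CoordRing n) (q : Fin r → CoordRing n), p.IsHomogeneous μ ∧ (∀ i, (q i).IsHomogeneous μ) ∧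
      f - y * p - ∑ i, rowForm A i * q i ∈ I := by
  obtain ⟨p, hp⟩ := mem_sup_span_singleton_iff.1 h
  obtain ⟨q, hq⟩ := mem_sup_span_range_iff.1 hp
  refine ⟨homogeneousComponent μ p, fun i => homogeneousComponent μ (q i),
    homogeneousComponent_isHomogeneous _ _, fun i => homogeneousComponent_isHomogeneous _ _, ?_⟩
  have h1 := homogeneousComponent_mem_of_mem hI hq (1 + μ)
  rw [map_sub, map_sub, homogeneousComponent_eq_self hf, homogeneousComponent_add_mul hy,
    map_sum] at h1
  simpa only [homogeneousComponent_add_mul (rowForm_isHomogeneous A _)] using h1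

variable {B : Type*} [CommRing B] [Algebra (ParamRing n r) B]
  {φ : MvPolynomial (Fin (n + 1)) (ParamRing n r) →ₐ[ParamRing n r] B}

theorem algHom_map_C_mul (φ : MvPolynomial (Fin (n + 1)) (ParamRing n r) →ₐ[ParamRing n r] B)
    (a : ℂ) (f : CoordRing n) :
    φ (MvPolynomial.map C (C a * f)) = (C a : ParamRing n r) • φ (MvPolynomial.map C f) := by
  rw [map_mul, map_C, ← MvPolynomial.smul_eq_C_mul, map_smul]

/-- The generic form vanishes on the family, so it may be subtracted; the new coefficients vanish at
the parameter `A`. -/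
theorem algHom_rowForm_mul (h : ∀ z ∈ univIdeal r I y, φ z = 0)
    (A : Matrix (Fin r) (Fin (n + 1)) ℂ) (i : Fin r) (q : CoordRing n) :
    φ (MvPolynomial.map C (rowForm A i * q)) =
      ∑ j, (C (A i j) - X (i, j) : ParamRing n r) • φ (MvPolynomial.map C (X j * q)) := by
  have h1 : φ (univForm i) * φ (MvPolynomial.map C q) = 0 := by
    have h0 : φ (univForm i) = 0 := (forall_mem_univIdeal_iff (φ := φ.toRingHom).1 h).2.1 i
    rw [h0, zero_mul]
  rw [univForm, map_sum, Finset.sum_mul] at h1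
  rw [rowForm, Finset.sum_mul, map_sum, map_sum, ← sub_zero (∑ x, φ _), ← h1,
    ← Finset.sum_sub_distrib]
  refine Finset.sum_congr rfl fun j _ => ?_
  rw [mul_assoc, algHom_map_C_mul, sub_smul, ← MvPolynomial.smul_eq_C_mul (X j) (X (i, j)),
    map_smul, smul_mul_assoc, ← map_mul]
  simp only [map_mul, map_X]

/-- Some nonzero polynomial in the parameters multiplies the forms of degree `1 + μ` on the
universal family into the module spanned by the forms of degree `μ`. -/
theorem exists_smul_mem_span_of_isHomogeneous (h : ∀ z ∈ univIdeal r I y, φ z = 0)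
    (hI : I.IsHomogeneous (homogeneousSubmodule (Fin (n + 1)) ℂ)) (hy : y.IsHomogeneous 1)
    {A₀ : Matrix (Fin r) (Fin (n + 1)) ℂ} {μ : ℕ}
    (hm : ∀ f : CoordRing n, f.IsHomogeneous (1 + μ) → f ∈ sectionIdeal I A₀ ⊔ Ideal.span {y}) :
    ∃ g : ParamRing n r, g ≠ 0 ∧ ∀ f : CoordRing n, f.IsHomogeneous (1 + μ) →
      g • φ (MvPolynomial.map C f) ∈ Submodule.span (ParamRing n r)
        ((fun p => φ (MvPolynomial.map C p)) '' {p : CoordRing n | p.IsHomogeneous μ}) := by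
  set U := Submodule.span (ParamRing n r)
        ((fun p => φ (MvPolynomial.map C p)) '' {p : CoordRing n | p.IsHomogeneous μ}) with hU
  have hφ := forall_mem_univIdeal_iff (φ := φ.toRingHom).1 h
  obtain ⟨d, e, he⟩ := Submodule.fg_iff_exists_fin_generating_family.1
    (homogeneousSubmodule_fg (Fin (n + 1)) ℂ (1 + μ))
  have hspan : ∀ f : CoordRing n, f.IsHomogeneous (1 + μ) →
      ∃ c : Fin d → ℂ, f = ∑ b, C (c b) * e b := by
    intro f hf
    have hf' : f ∈ Submodule.span ℂ (Set.range e) := by rw [he]; exact hf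
    obtain ⟨c, rfl⟩ := (Submodule.mem_span_range_iff_exists_fun ℂ).1 hf'
    exact ⟨c, by simp [smul_eq_C_mul]⟩
  have heh : ∀ b, (e b).IsHomogeneous (1 + μ) := fun b => by
    have : e b ∈ homogeneousSubmodule (Fin (n + 1)) ℂ (1 + μ) := by
      rw [← he]; exact Submodule.subset_span ⟨b, rfl⟩
    exact this
  have hφspan : ∀ c : Fin d → ℂ, φ (MvPolynomial.map C (∑ b, C (c b) * e b))
      = ∑ b, (C (c b) : ParamRing n r) • φ (MvPolynomial.map C (e b)) := fun c => by
    rw [map_sum, map_sum]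
    exact Finset.sum_congr rfl fun b _ => algHom_map_C_mul _ _ _
  choose p q hp hq hpq using fun b =>
    exists_isHomogeneous_of_mem_sectionIdeal_sup hI hy (heh b) (hm (e b) (heh b))
  choose c hc using fun (b : Fin d) (i : Fin r) (j : Fin (n + 1)) =>
    hspan (X j * q b i) ((isHomogeneous_X ℂ j).mul (hq b i))
  -- With `y = 1`, the relations expressing `e b` through `y` and the forms of `A₀` become `(1 - N)
  -- e = p`. Since `N` vanishes at `A₀`, the determinant of `1 - N` is 1 there, hence nonzero.
  let N : Matrix (Fin d) (Fin d) (ParamRing n r) := Matrix.of fun b b' =>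
    ∑ i, ∑ j, (C (A₀ i j) - X (i, j)) * C (c b i j b')
  have hN : ∀ b, φ (MvPolynomial.map C (e b)) - ∑ b', N b b' • φ (MvPolynomial.map C (e b'))
      = φ (MvPolynomial.map C (p b)) := by
    intro b
    have h1 : φ (MvPolynomial.map C (e b)) - φ (MvPolynomial.map C (p b))
        - ∑ i, φ (MvPolynomial.map C (rowForm A₀ i * q b i)) = 0 := by
      have h2 := hφ.1 _ (hpq b)
      have h3 : φ (MvPolynomial.map C y) = 1 := hφ.2.2
      have h4 : φ (MvPolynomial.map C (e b - y * p b - ∑ i, rowForm A₀ i * q b i)) = 0 := h2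
      rw [map_sub, map_sub, map_sub, map_sub, map_mul (MvPolynomial.map C) y, map_mul φ, h3,
        one_mul, map_sum, map_sum] at h4
      exact h4
    have h5 : ∑ i, φ (MvPolynomial.map C (rowForm A₀ i * q b i))
        = ∑ b', N b b' • φ (MvPolynomial.map C (e b')) := by
      simp only [algHom_rowForm_mul h, N, Matrix.of_apply, Finset.sum_smul]
      rw [Finset.sum_comm]
      conv_rhs => rw [Finset.sum_comm]
      rw [Finset.sum_comm]
      refine Finset.sum_congr rfl fun i _ => ?_
      rw [Finset.sum_comm]
      refine Finset.sum_congr rfl fun j _ => ?_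
      conv_lhs => rw [hc b i j, hφspan, Finset.smul_sum]
      simp only [mul_smul]
    rw [← h5]
    rw [sub_right_comm, sub_eq_zero] at h1
    exact h1
  have hdet : ∀ b, (1 - N).det • φ (MvPolynomial.map C (e b)) ∈ U := by
    refine det_smul_mem (1 - N) (fun b => φ (MvPolynomial.map C (e b))) U fun b => ?_
    simp only [Matrix.sub_apply, sub_smul, Finset.sum_sub_distrib, Matrix.one_apply, ite_smul,
      one_smul, zero_smul, Finset.sum_ite_eq, Finset.mem_univ, if_true, hN]
    exact Submodule.subset_span ⟨p b, hp b, rfl⟩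
  refine ⟨(1 - N).det, fun h0 => ?_, fun f hf => ?_⟩
  · have h1 := congrArg (eval fun ij : Fin r × Fin (n + 1) => A₀ ij.1 ij.2) h0
    rw [RingHom.map_det, map_zero] at h1
    have h2 : (eval fun ij : Fin r × Fin (n + 1) => A₀ ij.1 ij.2).mapMatrix (1 - N) = 1 := by
      ext b b'
      simp [N, Matrix.one_apply, apply_ite]
    rw [h2, Matrix.det_one] at h1
    exact one_ne_zero h1
  · obtain ⟨c, rfl⟩ := hspan f hf
    rw [hφspan, Finset.smul_sum]
    refine U.sum_mem fun b _ => ?_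
    rw [smul_comm]
    exact U.smul_mem _ (hdet b)

/-- The elements that are multiplied into a submodule by a power of `g`. -/
def powSaturation {A V : Type*} [CommRing A] [AddCommGroup V] [Module A V] (g : A)
    (W : Submodule A V) : Submodule A V where
  carrier := {z | ∃ e : ℕ, g ^ e • z ∈ W}
  zero_mem' := ⟨0, by simp⟩
  add_mem' := by
    rintro a b ⟨s, hs⟩ ⟨t, ht⟩
    refine ⟨s + t, ?_⟩
    rw [smul_add]
    refine W.add_mem ?_ ?_
    · rw [add_comm, pow_add, mul_smul]; exact W.smul_mem _ hs
    · rw [pow_add, mul_smul]; exact W.smul_mem _ ht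
  smul_mem' := by
    rintro c z ⟨s, hs⟩
    exact ⟨s, by rw [smul_comm]; exact W.smul_mem c hs⟩

theorem mem_powSaturation_of_smul_mem {A V : Type*} [CommRing A] [AddCommGroup V] [Module A V]
    {g : A} {W : Submodule A V} {z : V} (h : g • z ∈ powSaturation g W) : z ∈ powSaturation g W := by
  obtain ⟨e, he⟩ := h
  exact ⟨e + 1, by rwa [pow_succ, mul_smul]⟩

/-- The universal family is generically finite over the parameter space. -/
theorem exists_finset_forall_smul_mem_span (h : ∀ z ∈ univIdeal r I y, φ z = 0)
    (hφs : Function.Surjective φ)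
    (hI : I.IsHomogeneous (homogeneousSubmodule (Fin (n + 1)) ℂ)) (hy : y.IsHomogeneous 1)
    {A₀ : Matrix (Fin r) (Fin (n + 1)) ℂ} {μ : ℕ}
    (hm : ∀ f : CoordRing n, f.IsHomogeneous (1 + μ) → f ∈ sectionIdeal I A₀ ⊔ Ideal.span {y}) :
    ∃ t : Finset B, ∀ z : B, ∃ a : ParamRing n r, a ≠ 0 ∧
      a • z ∈ Submodule.span (ParamRing n r) (t : Set B) := by
  classical
  obtain ⟨g, hg0, hg⟩ := exists_smul_mem_span_of_isHomogeneous h hI hy hm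
  have ht : ∀ i, ∃ t : Finset (CoordRing n), Submodule.span ℂ (t : Set (CoordRing n))
      = homogeneousSubmodule (Fin (n + 1)) ℂ i := fun i => homogeneousSubmodule_fg _ _ i
  choose t ht using ht
  let T : Finset B := ((Finset.range (1 + μ)).biUnion t).image fun f => φ (MvPolynomial.map C f)
  set W := Submodule.span (ParamRing n r) (T : Set B) with hW
  -- One factor `g` lowers the degree of a form by one as long as the degree exceeds `μ`, so a power
  -- of `g` depending on the degree is needed.
  have hhom : ∀ i, ∀ f : CoordRing n, f.IsHomogeneous i →
      φ (MvPolynomial.map C f) ∈ powSaturation g W := by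
    intro i
    induction i using Nat.strong_induction_on with
    | _ i ih =>
      intro f hf
      rcases lt_or_ge i (1 + μ) with hi | hi
      · have hf' : f ∈ Submodule.span ℂ (t i : Set (CoordRing n)) := by rw [ht]; exact hf
        clear hf
        induction hf' using Submodule.span_induction with
        | mem x hx =>
          refine ⟨0, ?_⟩
          rw [pow_zero, one_smul]
          exact Submodule.subset_span (Finset.mem_coe.2 (Finset.mem_image.2
            ⟨x, Finset.mem_biUnion.2 ⟨i, Finset.mem_range.2 hi, hx⟩, rfl⟩))
        | zero => rw [map_zero, map_zero]; exact Submodule.zero_mem _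
        | add x y _ _ hx hy => rw [map_add, map_add]; exact Submodule.add_mem _ hx hy
        | smul c x _ hx =>
          rw [smul_eq_C_mul, algHom_map_C_mul]
          exact Submodule.smul_mem _ _ hx
      · obtain ⟨j, rfl⟩ := Nat.exists_eq_add_of_le hi
        have hf' : f ∈ homogeneousSubmodule (Fin (n + 1)) ℂ (1 + μ)
            * homogeneousSubmodule (Fin (n + 1)) ℂ j := by
          rw [← homogeneousSubmodule_one_pow ℂ (1 + μ), ← homogeneousSubmodule_one_pow ℂ j,
            ← pow_add, homogeneousSubmodule_one_pow]
          exact hf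
        clear hf
        refine Submodule.mul_induction_on hf' (fun u hu v hv => ?_) (fun a b ha hb => ?_)
        · refine mem_powSaturation_of_smul_mem ?_
          rw [map_mul, map_mul, ← smul_mul_assoc]
          have hg' := hg u hu
          generalize g • φ (MvPolynomial.map C u) = w at hg'
          induction hg' using Submodule.span_induction with
          | mem x hx =>
            obtain ⟨p, hp, rfl⟩ := hx
            rw [← map_mul, ← map_mul]
            exact ih (μ + j) (by omega) _ (IsHomogeneous.mul hp hv)
          | zero => rw [zero_mul]; exact Submodule.zero_mem _
          | add a b _ _ ha hb => rw [add_mul]; exact Submodule.add_mem _ ha hb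
          | smul c a _ ha => rw [smul_mul_assoc]; exact Submodule.smul_mem _ _ ha
        · rw [map_add, map_add]; exact Submodule.add_mem _ ha hb
  refine ⟨T, fun z => ?_⟩
  suffices hz : z ∈ powSaturation g W by
    obtain ⟨e, he⟩ := hz
    exact ⟨g ^ e, pow_ne_zero e hg0, he⟩
  obtain ⟨w, rfl⟩ := hφs z
  induction w using MvPolynomial.induction_on' with
  | monomial d a =>
    have h1 : monomial d a = a • MvPolynomial.map (σ := Fin (n + 1)) (C : ℂ →+* ParamRing n r)
        (monomial d 1) := by
      rw [map_monomial, map_one, smul_monomial, smul_eq_mul, mul_one]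
    rw [h1, map_smul]
    exact Submodule.smul_mem _ _ (hhom _ _ (isHomogeneous_monomial 1 rfl))
  | add p q hp hq => rw [map_add]; exact Submodule.add_mem _ hp hq

end UniversalFinite

/-! ### Bertini for linear sections -/

section Bertini

variable {n r : ℕ} {I : Ideal (CoordRing n)} {y : CoordRing n}

/-- Bertini: a general linear section, of the right dimension, of a reduced scheme is reduced. -/
theorem Generically.isRadical_sectionIdeal_sup
    (hI : I.IsHomogeneous (homogeneousSubmodule (Fin (n + 1)) ℂ)) (hrad : I.IsRadical)
    (hy : y.IsHomogeneous 1) {A₀ : Matrix (Fin r) (Fin (n + 1)) ℂ} {μ : ℕ}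
    (hm : ∀ f : CoordRing n, f.IsHomogeneous (1 + μ) → f ∈ sectionIdeal I A₀ ⊔ Ideal.span {y}) :
    Generically fun A : Matrix (Fin r) (Fin (n + 1)) ℂ =>
      (sectionIdeal I A ⊔ Ideal.span {y - 1}).IsRadical := by
  obtain ⟨c, hc⟩ := exists_eq_sum_C_mul_X hy
  have hred : IsReduced (MvPolynomial (Fin (n + 1)) (ParamRing n r) ⧸ univIdeal r I y) :=
    isReduced_quotient_univIdeal (isRadical_sup_span_sub_one hI hrad hy) hc
  have hfin : ∃ t : Finset (MvPolynomial (Fin (n + 1)) (ParamRing n r) ⧸ univIdeal r I y),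
      ∀ z : MvPolynomial (Fin (n + 1)) (ParamRing n r) ⧸ univIdeal r I y, ∃ a : ParamRing n r,
        a ≠ 0 ∧ a • z ∈ Submodule.span (ParamRing n r)
          (t : Set (MvPolynomial (Fin (n + 1)) (ParamRing n r) ⧸ univIdeal r I y)) := by
    refine exists_finset_forall_smul_mem_span
      (B := MvPolynomial (Fin (n + 1)) (ParamRing n r) ⧸ univIdeal r I y)
      (φ := AlgHom.mk (Ideal.Quotient.mk (univIdeal r I y)) fun _ => rfl) ?_ ?_ hI hy hm
    · exact fun z hz => Ideal.Quotient.eq_zero_iff_mem.2 hz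
    · exact Ideal.Quotient.mk_surjective
  obtain ⟨t, ht⟩ := hfin
  obtain ⟨P, hP0, hP⟩ := exists_ne_zero_forall_isReduced
    (fun j : Fin (n + 1) => Ideal.Quotient.mk (univIdeal r I y) (X j)) t ht
  refine ⟨P, hP0, fun A hA => ?_⟩
  refine (Ideal.isRadical_iff_quotient_reduced _).2 ?_
  set J := sectionIdeal I A ⊔ Ideal.span {y - 1} with hJ
  let ψ : MvPolynomial (Fin (n + 1)) (ParamRing n r) →+* CoordRing n ⧸ J :=
    (Ideal.Quotient.mk J).comp (MvPolynomial.map (eval fun ij => A ij.1 ij.2))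
  have hψC : ∀ f : CoordRing n, ψ (MvPolynomial.map C f) = Ideal.Quotient.mk J f := by
    intro f
    simp only [ψ, RingHom.comp_apply, MvPolynomial.map_map]
    congr 1
    have : (eval fun ij : Fin r × Fin (n + 1) => A ij.1 ij.2).comp C = RingHom.id ℂ := by
      ext1 z; simp
    rw [this, MvPolynomial.map_id]
  have hψ : ∀ z ∈ univIdeal r I y, ψ z = 0 := by
    refine forall_mem_univIdeal_iff.2 ⟨fun f hf => ?_, fun i => ?_, ?_⟩
    · rw [hψC, Ideal.Quotient.eq_zero_iff_mem]
      exact Ideal.mem_sup_left (Ideal.mem_sup_left hf)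
    · have : MvPolynomial.map (eval fun ij : Fin r × Fin (n + 1) => A ij.1 ij.2)
          (univForm i : MvPolynomial (Fin (n + 1)) _) = rowForm A i := by
        simp [univForm, rowForm]
      simp only [ψ, RingHom.comp_apply]
      rw [this, Ideal.Quotient.eq_zero_iff_mem]
      exact Ideal.mem_sup_left (Ideal.mem_sup_right (Ideal.subset_span ⟨i, rfl⟩))
    · rw [hψC, ← sub_eq_zero, ← map_one (Ideal.Quotient.mk J), ← map_sub,
        Ideal.Quotient.eq_zero_iff_mem]
      exact Ideal.mem_sup_right (Ideal.mem_span_singleton_self _)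
  refine hP ℂ (CoordRing n ⧸ J) (eval fun ij => A ij.1 ij.2) (Ideal.Quotient.lift _ ψ hψ)
    (fun a => ?_) ?_ hA
  · have h1 : algebraMap (ParamRing n r) (MvPolynomial (Fin (n + 1)) (ParamRing n r) ⧸ univIdeal r I y) a
        = Ideal.Quotient.mk _ (C a) := rfl
    rw [h1, Ideal.Quotient.lift_mk]
    simp only [ψ, RingHom.comp_apply, map_C]
    rfl
  · have h1 : (Set.range fun j : Fin (n + 1) => Ideal.Quotient.lift _ ψ hψ
        (Ideal.Quotient.mk (univIdeal r I y) (X j)))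
        = Ideal.Quotient.mkₐ ℂ J '' Set.range (X : Fin (n + 1) → CoordRing n) := by
      rw [← Set.range_comp]
      congr 1
      funext j
      rw [Ideal.Quotient.lift_mk]
      simp [ψ]
    rw [h1, ← AlgHom.map_adjoin, MvPolynomial.adjoin_range_X, Algebra.map_top,
      AlgHom.range_eq_top]
    exact Ideal.Quotient.mkₐ_surjective _ _

end Bertini

/-! ### The ideal of the points of a section -/

section SectionPoints

variable {n r : ℕ}

theorem aeval_smul_apply_of_isHomogeneous {σ k : Type*} [Field k] [Fintype σ]
    {f : MvPolynomial σ k} {d : ℕ} (hf : f.IsHomogeneous d) (c : k) (v : σ → k) :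
    aeval (c • v) f = c ^ d * aeval v f := by
  rw [aeval_eq_eval, aeval_eq_eval, eval_eq', eval_eq',
    Finset.mul_sum]
  refine Finset.sum_congr rfl fun m hm => ?_
  have h : ∑ i, m i = d := by
    rw [← Finsupp.degree_eq_sum, ← hf (mem_support_iff.1 hm), Finsupp.degree_eq_weight_one]
    rfl
  simp only [Pi.smul_apply, smul_eq_mul, mul_pow, Finset.prod_mul_distrib, Finset.prod_pow_eq_pow_sum,
    h]
  ring

theorem smul_mem_zeroLocus {σ k : Type*} [Field k] [Fintype σ] {J : Ideal (MvPolynomial σ k)}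
    (hJ : J.IsHomogeneous (homogeneousSubmodule σ k)) {v : σ → k} (hv : v ∈ zeroLocus k J) (c : k) :
    c • v ∈ zeroLocus k J := by
  intro f hf
  rw [← sum_homogeneousComponent f, map_sum]
  refine Finset.sum_eq_zero fun i _ => ?_
  rw [aeval_smul_apply_of_isHomogeneous (homogeneousComponent_isHomogeneous i f),
    hv _ (homogeneousComponent_mem_of_mem hJ hf i), mul_zero]

theorem aeval_rowForm (A : Matrix (Fin r) (Fin (n + 1)) ℂ) (i : Fin r) (v : Fin (n + 1) → ℂ) :
    aeval v (rowForm A i) = A.mulVec v i := by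
  simp [rowForm, Matrix.mulVec, dotProduct]

theorem mem_zeroLocus_sectionIdeal {I : Ideal (CoordRing n)}
    {A : Matrix (Fin r) (Fin (n + 1)) ℂ} {v : Fin (n + 1) → ℂ} :
    v ∈ zeroLocus ℂ (sectionIdeal I A) ↔
      v ∈ zeroLocus ℂ I ∧ v ∈ LinearMap.ker A.mulVecLin := by
  rw [LinearMap.mem_ker, Matrix.mulVecLin_apply]
  constructor
  · refine fun h => ⟨fun f hf => h f (Ideal.mem_sup_left hf), funext fun i => ?_⟩
    rw [← aeval_rowForm]
    exact h _ (Ideal.mem_sup_right (Ideal.subset_span ⟨i, rfl⟩))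
  · rintro ⟨h1, h2⟩ f hf
    suffices h : sectionIdeal I A ≤ RingHom.ker (aeval v : CoordRing n →ₐ[ℂ] ℂ) from h hf
    refine sup_le (fun f hf => h1 f hf) (Ideal.span_le.2 ?_)
    rintro _ ⟨i, rfl⟩
    exact (aeval_rowForm A i v).trans (congrFun h2 i)

theorem aeval_zero_eq_zero_of_mem {I : Ideal (CoordRing n)}
    (hI : I.IsHomogeneous (homogeneousSubmodule (Fin (n + 1)) ℂ)) (hI1 : I ≠ ⊤) {f : CoordRing n}
    (hf : f ∈ I) : aeval (0 : Fin (n + 1) → ℂ) f = 0 := by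
  by_contra h
  have h1 := homogeneousComponent_mem_of_mem hI hf 0
  rw [homogeneousComponent_zero] at h1
  refine hI1 (Ideal.eq_top_of_isUnit_mem _ h1 (IsUnit.map C (IsUnit.mk0 _ ?_)))
  rwa [aeval_zero, constantCoeff_eq] at h

theorem sectionIdeal_ne_top {I : Ideal (CoordRing n)}
    (hI : I.IsHomogeneous (homogeneousSubmodule (Fin (n + 1)) ℂ)) (hI1 : I ≠ ⊤)
    (A : Matrix (Fin r) (Fin (n + 1)) ℂ) : sectionIdeal I A ≠ ⊤ := by
  intro h
  have h0 : (0 : Fin (n + 1) → ℂ) ∈ zeroLocus ℂ (sectionIdeal I A) :=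
    mem_zeroLocus_sectionIdeal.2 ⟨fun f hf => aeval_zero_eq_zero_of_mem hI hI1 hf,
      Submodule.zero_mem _⟩
  have h1 := h0 1 (h ▸ Submodule.mem_top)
  rw [map_one] at h1
  exact one_ne_zero h1

theorem le_irrelevantIdeal {I : Ideal (CoordRing n)}
    (hI : I.IsHomogeneous (homogeneousSubmodule (Fin (n + 1)) ℂ)) (hI1 : I ≠ ⊤) :
    I ≤ irrelevantIdeal n := by
  intro f hf
  rw [irrelevantIdeal, ← Set.image_univ, mem_ideal_span_X_image]
  intro m hm
  have h1 := aeval_zero_eq_zero_of_mem hI hI1 hf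
  rw [aeval_zero, constantCoeff_eq] at h1
  have h2 : m ≠ 0 := by
    rintro rfl
    exact mem_support_iff.1 hm h1
  obtain ⟨i, hi⟩ := Finsupp.ne_iff.1 h2
  exact ⟨i, Set.mem_univ i, hi⟩

theorem span_homogeneousSubmodule_one (n : ℕ) :
    Ideal.span (homogeneousSubmodule (Fin (n + 1)) ℂ 1 : Set (CoordRing n)) = irrelevantIdeal n := by
  rw [homogeneousSubmodule_one_eq_span_X]
  exact Submodule.span_span_of_tower _ _ _

/-- The ideal of the points of a linear section whose ideal is radical and has a regular linear
form is the ideal of the linear section. -/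
theorem pointsIdeal_inter_projLinearSpace {V : ProjSubscheme n} (hV : V.ideal ≠ ⊤)
    {A : Matrix (Fin r) (Fin (n + 1)) ℂ} {y : CoordRing n} (hy : y.IsHomogeneous 1)
    (hreg : IsRegularMod (sectionIdeal V.ideal A) y) (hrad : (sectionIdeal V.ideal A).IsRadical) :
    pointsIdeal (V.points ∩ projLinearSpace (LinearMap.ker A.mulVecLin)) =
      sectionIdeal V.ideal A := by
  have hJ := sectionIdeal_isHomogeneous V.isHomogeneous A
  have hW : ∀ p : ProjPoint n, p ∈ V.points ∩ projLinearSpace (LinearMap.ker A.mulVecLin) ↔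
      (p.submodule : Set (Fin (n + 1) → ℂ)) ⊆ zeroLocus ℂ (sectionIdeal V.ideal A) := by
    intro p
    refine ⟨fun h v hv => mem_zeroLocus_sectionIdeal.2 ⟨h.1 hv, h.2 hv⟩, fun h => ⟨?_, ?_⟩⟩
    · exact fun v hv => (mem_zeroLocus_sectionIdeal.1 (h hv)).1
    · exact fun v hv => (mem_zeroLocus_sectionIdeal.1 (h hv)).2
  have hmk : ∀ (v : Fin (n + 1) → ℂ) (hv : v ≠ 0), v ∈ zeroLocus ℂ (sectionIdeal V.ideal A) →
      Projectivization.mk ℂ v hv ∈ V.points ∩ projLinearSpace (LinearMap.ker A.mulVecLin) := by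
    intro v hv h
    rw [hW, Projectivization.submodule_mk]
    intro w hw
    obtain ⟨c, rfl⟩ := Submodule.mem_span_singleton.1 hw
    exact smul_mem_zeroLocus hJ h c
  have hrad' : vanishingIdeal ℂ (zeroLocus ℂ (sectionIdeal V.ideal A)) = sectionIdeal V.ideal A := by
    rw [vanishingIdeal_zeroLocus_eq_radical, hrad.radical]
  -- The origin lies on the affine cone but on a line of W only if W is nonempty. Were it the only
  -- zero, `y` would lie in the radical section ideal, and its regularity would make that ideal the
  -- whole ring.
  have hne : ∃ v ∈ zeroLocus ℂ (sectionIdeal V.ideal A), v ≠ 0 := by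
    by_contra! h
    have h1 : y * 1 ∈ sectionIdeal V.ideal A := by
      rw [mul_one, ← hrad']
      intro v hv
      rw [h v hv, ← zero_smul ℂ (0 : Fin (n + 1) → ℂ), aeval_smul_apply_of_isHomogeneous hy, pow_one, zero_mul]
    exact sectionIdeal_ne_top V.isHomogeneous hV A ((Ideal.eq_top_iff_one _).2 (hreg _ h1))
  refine le_antisymm (fun f hf => ?_) (fun f hf => ?_)
  · rw [← hrad']
    intro v hv
    obtain rfl | hv0 := eq_or_ne v 0
    · obtain ⟨w, hw, hw0⟩ := hne
      exact hf _ ⟨_, hmk w hw0 hw, Submodule.zero_mem _⟩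
    · refine hf _ ⟨_, hmk v hv0 hv, ?_⟩
      rw [Projectivization.submodule_mk]
      exact Submodule.mem_span_singleton_self v
  · rintro v ⟨p, hp, hv⟩
    exact (hW p).1 hp hv f hf

end SectionPoints

/-! ### Differences, iterated sums and generating series -/

section Series

theorem firstDifference_partialSum (h : ℕ → ℕ) :
    firstDifference (partialSum h) = partialSum (firstDifference h) := by
  funext k
  induction k with
  | zero => simp [firstDifference, partialSum_zero]
  | succ k ih =>
    rw [partialSum_succ, ← ih]
    cases k with
    | zero => simp [firstDifference, partialSum_succ, partialSum_zero]
    | succ k => simp only [firstDifference, partialSum_succ]; push_cast; ring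

theorem firstDifference_partialSum_iterate (r : ℕ) (h : ℕ → ℕ) :
    firstDifference (partialSum^[r] h) = partialSum^[r] (firstDifference h) := by
  induction r with
  | zero => rfl
  | succ r ih =>
    rw [Function.iterate_succ_apply', firstDifference_partialSum, ih, Function.iterate_succ_apply']

theorem natCast_partialSum_iterate (r : ℕ) (h : ℕ → ℕ) :
    (fun k => ((partialSum^[r] h k : ℕ) : ℤ)) = partialSum^[r] fun k => (h k : ℤ) := by
  induction r with
  | zero => rfl
  | succ r ih =>
    rw [Function.iterate_succ_apply', Function.iterate_succ_apply', ← ih]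
    funext k
    simp [partialSum]

theorem hilbertSeries_partialSum_mul (h : ℕ → ℤ) :
    hilbertSeries (partialSum h) * (1 - PowerSeries.X) = hilbertSeries h := by
  ext k
  rw [mul_sub, mul_one, map_sub]
  cases k with
  | zero => simp [hilbertSeries, partialSum_zero]
  | succ k => simp [hilbertSeries, partialSum_succ, PowerSeries.coeff_succ_mul_X]

theorem hilbertSeries_partialSum_iterate (r : ℕ) (h : ℕ → ℤ) :
    hilbertSeries (partialSum^[r] h) = hilbertSeries h * ((1 - PowerSeries.X) ^ r)⁻¹ := by
  rw [PowerSeries.eq_mul_inv_iff_mul_eq (by simp)]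
  induction r with
  | zero => simp
  | succ r ih =>
    rw [Function.iterate_succ_apply', pow_succ', ← mul_assoc, hilbertSeries_partialSum_mul, ih]

end Series

/-! ### Assembly -/

/-- The linear forms that a Cohen-Macaulay homogeneous coordinate ring has as a regular
sequence. -/
theorem ProjSubscheme.IsACM.exists_isRegularSeqMod {n r : ℕ} {V : ProjSubscheme n}
    (haCM : V.IsACM) (hdim : V.HasDim r) (hV : V.ideal ≠ ⊤) :
    ∃ l : Fin (r + 1) → CoordRing n, (∀ i, (l i).IsHomogeneous 1) ∧
      IsRegularSeqMod V.ideal (List.ofFn l) := by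
  have hd : moduleDepth ((irrelevantIdeal n).map (Ideal.Quotient.mk V.ideal)) V.coordRing
      = ((r + 1 : ℕ) : ℕ∞) := by
    have h : ((moduleDepth ((irrelevantIdeal n).map (Ideal.Quotient.mk V.ideal)) V.coordRing : ℕ∞) :
      WithBot ℕ∞) = (((r + 1 : ℕ) : ℕ∞) : WithBot ℕ∞) := haCM.trans hdim
    exact WithBot.coe_injective h
  have h1 : DepthGE (irrelevantIdeal n) (r + 1) V.ideal :=
    DepthGE.of_le_moduleDepth (le_irrelevantIdeal V.isHomogeneous hV) hd.ge
  rw [← span_homogeneousSubmodule_one] at h1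
  obtain ⟨l, hl, hlE, hreg⟩ := h1.exists_isRegularSeqMod (homogeneousSubmodule (Fin (n + 1)) ℂ 1)
  obtain ⟨f, rfl⟩ : ∃ f : Fin (r + 1) → CoordRing n, l = List.ofFn f :=
    ⟨fun i => l.get (i.cast hl.symm), List.ext_getElem (by simp [hl]) fun i _ _ => by
      rw [List.getElem_ofFn]; rfl⟩
  exact ⟨f, fun i => hlE _ (List.mem_ofFn.2 ⟨i, rfl⟩), hreg⟩

theorem ofList_ofFn {R : Type*} [CommRing R] {d : ℕ} (l : Fin d → R) :
    Ideal.ofList (List.ofFn l) = Ideal.span (Set.range l) := by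
  rw [Ideal.ofList]
  congr 1
  ext; simp

/-- The ideal of the points of a general linear section of an arithmetically Cohen-Macaulay
generically reduced scheme, and its Hilbert function. -/
theorem ProjSubscheme.IsACM.forGeneralLinearSpace_hilbertFunction_eq {n r : ℕ} {V : ProjSubscheme n}
    (haCM : V.IsACM) (hdim : V.HasDim r) (hred : V.IsGenericallyReduced) :
    ForGeneralLinearSpace n r fun L =>
      hilbertFunction V.ideal =
        partialSum^[r] (hilbertFunction (pointsIdeal (V.points ∩ projLinearSpace L))) := by
  have hV : V.ideal ≠ ⊤ := by
    intro h
    have : Subsingleton V.coordRing := Ideal.Quotient.subsingleton_iff.2 h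
    rw [ProjSubscheme.HasDim, ringKrullDim_eq_bot_of_subsingleton] at hdim
    exact absurd hdim (WithBot.coe_ne_bot (a := ((r + 1 : ℕ) : ℕ∞))).symm
  obtain ⟨l, hl, hreg⟩ := haCM.exists_isRegularSeqMod hdim hV
  have hlhom : (V.ideal ⊔ Ideal.span (Set.range l)).IsHomogeneous
      (homogeneousSubmodule (Fin (n + 1)) ℂ) :=
    V.isHomogeneous.sup_span (d := 1) (by rintro _ ⟨i, rfl⟩; exact hl i)
  have hle0 : ringKrullDim (CoordRing n ⧸ V.ideal ⊔ Ideal.span (Set.range l)) ≤ 0 := by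
    have h1 := hreg.ringKrullDim_add_length_le
    rw [ofList_ofFn, List.length_ofFn] at h1
    exact WithBot.le_zero_of_add_natCast_le (h1.trans hdim.le)
  obtain ⟨m, hm⟩ := exists_forall_isHomogeneous_mem_of_ringKrullDim_le_zero hlhom hle0
  obtain ⟨s, hs, hs0⟩ := exists_isRegularMod_radical_of_genericallyReduced ℂ V.ideal hred
  have hrad : V.ideal.IsRadical :=
    isRadical_of_isRegularSeqMod V.isHomogeneous hl hm hdim.le hreg hs hs0
  -- Only the first `r` forms are varied; the last one stays fixed as the equation at infinity for
  -- all sections.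
  obtain ⟨A₀, hA₀⟩ := exists_rowForm_eq fun i : Fin r => hl i.castSucc
  set y := l (Fin.last r) with hy
  have hyh : y.IsHomogeneous 1 := hl _
  have hsplit : List.ofFn l = List.ofFn (rowForm A₀) ++ [y] := by
    rw [List.ofFn_succ', List.concat_eq_append, hA₀]
  have hideal : V.ideal ⊔ Ideal.span (Set.range l) = sectionIdeal V.ideal A₀ ⊔ Ideal.span {y} := by
    rw [← ofList_ofFn, hsplit, Ideal.ofList_append, ofList_ofFn, Ideal.ofList_singleton,
      ← sup_assoc, sectionIdeal]
  rw [hsplit] at hreg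
  rw [hideal] at hm
  have h1 : Generically fun A : Matrix (Fin r) (Fin (n + 1)) ℂ => A.rank = Fintype.card (Fin r) :=
    Generically.rank_eq (linearIndependent_row_of_isRegularSeqMod V.isHomogeneous hV
      (isRegularSeqMod_append.1 hreg).1)
  have h2 := Generically.hilbertFunction_sectionIdeal V.isHomogeneous hyh hreg hm
  have h3 := Generically.isRadical_sectionIdeal_sup V.isHomogeneous hrad hyh (A₀ := A₀) (μ := m)
    fun f hf => hm _ (by omega) f hf
  refine ((h1.and h2).and h3).mono fun A hA => ⟨hA.1.1.trans (Fintype.card_fin r), ?_⟩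
  obtain ⟨⟨-, hHF, hyreg⟩, hrad1⟩ := hA
  have hJrad := isRadical_of_isRadical_sup_span_sub_one
    (sectionIdeal_isHomogeneous V.isHomogeneous A) hyh hyreg hrad1
  rw [pointsIdeal_inter_projLinearSpace hV hyh hyreg hJrad]
  exact hHF

end

theorem mainTheorem1 (n r : ℕ) (V : ProjSubscheme n)
    (hdim : V.HasDim r) (hred : V.IsGenericallyReduced) (haCM : V.IsACM) :
    ForGeneralLinearSpace n r fun L =>
      let W : Set (ProjPoint n) := V.points ∩ projLinearSpace L
      let HV : ℕ → ℕ := hilbertFunction V.ideal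
      let HW : ℕ → ℕ := hilbertFunction (pointsIdeal W)
      (∀ k, HV k = partialSum^[r] HW k) ∧
      hilbertSeries (fun k => (HV k : ℤ)) =
        hilbertSeries (fun k => (HW k : ℤ)) * ((1 - PowerSeries.X) ^ r)⁻¹ ∧
      (∀ k, firstDifference HV k = partialSum^[r] (firstDifference HW) k) ∧
      hilbertSeries (firstDifference HV) =
        hilbertSeries (firstDifference HW) * ((1 - PowerSeries.X) ^ r)⁻¹ := by
  obtain ⟨P, hP, h⟩ := haCM.forGeneralLinearSpace_hilbertFunction_eq hdim hred
  refine ⟨P, hP, fun A hA => ⟨(h A hA).1, ?_⟩⟩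
  beta_reduce
  intro W HV HW
  have hHV : HV = partialSum^[r] HW := (h A hA).2
  rw [hHV]
  refine ⟨fun _ => rfl, ?_, fun _ => ?_, ?_⟩
  · rw [natCast_partialSum_iterate, hilbertSeries_partialSum_iterate]
  · rw [firstDifference_partialSum_iterate]
  · rw [firstDifference_partialSum_iterate, hilbertSeries_partialSum_iterate]
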